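/- **Proposition B.1.** Consider a random walk $(X_n)_{n\ge 0}$ in an i.i.d. random environment on $\mathbb Z^d$. That is, the environment is $\omega=(\omega_x)_{x\in\mathbb Z^d}$, where each $\omega_x=(\omega_{x,z})_{z\in\mathbb Z^d}$ is a probability vector on $\mathbb Z^d$ and the $\omega_x$ are i.i.d. under the law $\mathbb P$. Given $\omega$, under $P_0^\omega$ the walk $X$ is the Markov chain started at $0$ that jumps from $x$ to $x+z$ with probability $\omega_{x,z}$. Let $P_0=\int P_0^\omega(\cdot)\,\mathbb P(d\omega)$ be the averaged law of the walk, with expectation $E_0$. Assume bounded steps: there is a finite constant $\mathbb M>0$ such that $\mathbb P(\omega_{0,z}=0)=1$ whenever $|z|>\mathbb M$. For a vector $\hat a\in\mathbb R^d$, the first regeneration time in direction $\hat a$ is the first $n\ge 1$ such that $X_m\cdot\hat a<X_n\cdot\hat a$ for all $m<n$ and $X_m\cdot\hat a\ge X_n\cdot\hat a$ for all $m\ge n$ ($\infty$ if there is no such $n$). Let $\hat w\in\mathbb R^d$ satisfy $P_0\{X_n\cdot\hat w\to\infty\}=1$, let $\sigma_1$ be the first regeneration time in direction $\hat w$, and assume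 $E_0(\sigma_1^{p_3})<\infty$ for some real $p_3>6$. Let $\hat\beta=\inf\{n\ge 0: X_n\cdot\hat w<X_0\cdot\hat w\}$ be the first backtracking time in direction $\hat w$ ($\inf\emptyset=\infty$), and let $$v=\frac{E_0[X_{\sigma_1}\mid\hat\beta=\infty]}{E_0[\sigma_1\mid\hat\beta=\infty]}\in\mathbb R^d .$$ Then for every $\hat u\in\mathbb R^d$ with $\hat u\cdot v>0$ we have $$P_0\{X_n\cdot\hat u\to\infty\}=1,$$ and the first regeneration time $\tau_1$ in direction $\hat u$ satisfies $E_0(\tau_1^{p_0})<\infty$ for every real $p_0<p_3/2-2$. -/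

import Mathlib

open MeasureTheory ProbabilityTheory Filter Topology
open scoped ENNReal

namespace RWRE

/-- Sites of the lattice `ℤ^d`. -/
abbrev Site (d : ℕ) : Type := Fin d → ℤ

/-- A lattice site seen as a vector of the Euclidean space `ℝ^d`. -/
noncomputable def toVec {d : ℕ} (x : Site d) : EuclideanSpace ℝ (Fin d) :=
  WithLp.toLp 2 (fun i => (x i : ℝ))

/-- The simplex of probability vectors on `ℤ^d` (laws of one jump). -/
abbrev JumpLaw (d : ℕ) : Type := PMF (Site d)

/-- The σ-field on probability vectors generated by the coordinates. -/
instance instMeasurableSpaceJumpLaw (d : ℕ) : MeasurableSpace (JumpLaw d) :=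
  MeasurableSpace.comap (fun (p : JumpLaw d) (z : Site d) => p z) inferInstance

/-- Environments: `ω x z` is the probability of jumping from `x` to `x + z`.
The space of environments carries the product σ-field. -/
abbrev Env (d : ℕ) : Type := Site d → JumpLaw d

/-- Infinite paths on the lattice, with the product σ-field. -/
abbrev Path (d : ℕ) : Type := ℕ → Site d

/-- The law of the next site in the environment `ω`, given the path up to time `n`. -/
noncomputable def stepKernel {d : ℕ} (ω : Env d) (n : ℕ) :
    Kernel (Finset.Iic n → Site d) (Site d) where
  toFun h := (ω (h ⟨n, Finset.mem_Iic.2 le_rfl⟩)).toMeasure.map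
    (fun z => h ⟨n, Finset.mem_Iic.2 le_rfl⟩ + z)
  measurable' := Measurable.of_discrete

instance instIsMarkovKernelStepKernel {d : ℕ} (ω : Env d) (n : ℕ) :
    IsMarkovKernel (stepKernel ω n) :=
  ⟨fun _ => Measure.isProbabilityMeasure_map Measurable.of_discrete.aemeasurable⟩

/-- The quenched path measure: the law of the Markov chain in the environment `ω`
started at `x`. -/
noncomputable def quenchedLaw {d : ℕ} (x : Site d) (ω : Env d) : Measure (Path d) :=
  Kernel.traj (X := fun _ => Site d) (stepKernel ω) 0 (fun _ => x)

instance instIsProbabilityMeasureQuenchedLaw {d : ℕ} (x : Site d) (ω : Env d) :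
    IsProbabilityMeasure (quenchedLaw x ω) := by
  unfold quenchedLaw; infer_instance

theorem measurable_toMeasure {d : ℕ} (S : Set (Site d)) :
    Measurable (fun p : JumpLaw d => p.toMeasure S) := by
  have hS : MeasurableSet S := MeasurableSet.of_discrete
  simp_rw [PMF.toMeasure_apply _ hS]
  refine Measurable.tsum fun z => ?_
  have hz : Measurable (fun p : JumpLaw d => p z) :=
    (measurable_pi_apply z).comp (comap_measurable _)
  by_cases h : z ∈ S
  · simpa [Set.indicator_of_mem h] using hz
  · simp [Set.indicator_of_notMem h]

theorem measurable_stepKernel {d : ℕ} (n : ℕ) (h : Finset.Iic n → Site d) (S : Set (Site d)) :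
    Measurable (fun ω : Env d => stepKernel ω n h S) := by
  have : ∀ ω : Env d, stepKernel ω n h S = (ω (h ⟨n, Finset.mem_Iic.2 le_rfl⟩)).toMeasure
      ((fun z => h ⟨n, Finset.mem_Iic.2 le_rfl⟩ + z) ⁻¹' S) := fun ω =>
    Measure.map_apply Measurable.of_discrete MeasurableSet.of_discrete
  simp_rw [this]
  exact (measurable_toMeasure _).comp (measurable_pi_apply _)

theorem measurable_partialTraj {d : ℕ} (x : Site d) (n : ℕ) (S : Set (Finset.Iic n → Site d)) :
    Measurable (fun ω : Env d =>
      Kernel.partialTraj (X := fun _ => Site d) (stepKernel ω) 0 n (fun _ => x) S) := by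
  induction n with
  | zero => simp [Kernel.partialTraj_self]
  | succ n ih =>
    have hone : ∀ h : Finset.Iic n → Site d, Measurable (fun ω : Env d =>
        Kernel.partialTraj (X := fun _ => Site d) (stepKernel ω) n (n + 1) h S) := by
      intro h
      have key : ∀ ω : Env d,
          Kernel.partialTraj (X := fun _ => Site d) (stepKernel ω) n (n + 1) h S =
          stepKernel ω n h ((MeasurableEquiv.piSingleton (X := fun _ => Site d) n) ⁻¹'
            (Prod.mk h ⁻¹' (IicProdIoc (X := fun _ => Site d) n (n + 1) ⁻¹' S))) := by
        intro ω
        rw [Kernel.partialTraj_succ_self]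
        refine (Kernel.map_apply' _ (measurable_IicProdIoc (X := fun _ => Site d)) _
          MeasurableSet.of_discrete).trans ?_
        rw [Kernel.prod_apply, Kernel.id_apply,
          Measure.prod_apply MeasurableSet.of_discrete, lintegral_dirac,
          Kernel.map_apply' _ (MeasurableEquiv.measurable _) _ MeasurableSet.of_discrete]
      simp_rw [key]
      exact measurable_stepKernel n h _
    have hsum : ∀ ω : Env d,
        Kernel.partialTraj (X := fun _ => Site d) (stepKernel ω) 0 (n + 1) (fun _ => x) S =
        ∑' h : Finset.Iic n → Site d,
          Kernel.partialTraj (X := fun _ => Site d) (stepKernel ω) n (n + 1) h S *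
          Kernel.partialTraj (X := fun _ => Site d) (stepKernel ω) 0 n (fun _ => x) {h} := by
      intro ω
      rw [Kernel.partialTraj_succ_eq_comp (Nat.zero_le n),
        Kernel.comp_apply' _ _ _ MeasurableSet.of_discrete, lintegral_countable']
    simp_rw [hsum]
    exact Measurable.tsum fun h => (hone h).mul (ih {h})

/-- The quenched path measure depends measurably on the environment. -/
theorem measurable_quenchedLaw {d : ℕ} (x : Site d) : Measurable (quenchedLaw (d := d) x) := by
  refine Measurable.measure_of_isPiSystem_of_isProbabilityMeasure
    (S := measurableCylinders (fun _ : ℕ => Site d))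
    generateFrom_measurableCylinders.symm isPiSystem_measurableCylinders (fun t ht => ?_)
  obtain ⟨N, S, mS, rfl⟩ : ∃ N S, MeasurableSet S ∧ t = cylinder (Finset.Iic N) S := by
    simpa [measurableCylinders_nat] using ht
  have : ∀ ω : Env d, quenchedLaw x ω (cylinder (Finset.Iic N) S) =
      Kernel.partialTraj (X := fun _ => Site d) (stepKernel ω) 0 N (fun _ => x) S := by
    intro ω
    rw [← Kernel.traj_map_frestrictLe_apply,
      Measure.map_apply (Preorder.measurable_frestrictLe N) mS]
    rfl
  simp_rw [this]
  exact measurable_partialTraj x N S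

/-- The i.i.d. product law of the environment, with marginal `μ` at every site. -/
noncomputable def envLaw {d : ℕ} (μ : Measure (JumpLaw d)) : Measure (Env d) :=
  Measure.infinitePi (fun _ : Site d => μ)

/-- The averaged law `P₀` of the walk started at the origin:
`P₀(A) = ∫ P₀^ω(A) ℙ(dω)`. -/
noncomputable def averagedLaw {d : ℕ} (μ : Measure (JumpLaw d)) : Measure (Path d) :=
  (envLaw μ).bind (quenchedLaw 0)

/-- Bounded steps: for some finite constant `M > 0`, for every `z` with `|z| > M`
(Euclidean norm), almost surely the jump `z` from the origin has probability zero. -/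
def BoundedSteps {d : ℕ} (μ : Measure (JumpLaw d)) : Prop :=
  ∃ M : ℝ, 0 < M ∧ ∀ z : Site d, M < ‖toVec z‖ → ∀ᵐ ω ∂(envLaw μ), ω 0 z = 0

/-- The height `x · u` of a site `x` in the direction `u`. -/
noncomputable def height {d : ℕ} (u : EuclideanSpace ℝ (Fin d)) (x : Site d) : ℝ :=
  inner ℝ (toVec x) u

/-- Transience in direction `u`: `P₀(Xₙ · u → ∞) = 1`. -/
def TransientIn {d : ℕ} (μ : Measure (JumpLaw d)) (u : EuclideanSpace ℝ (Fin d)) : Prop :=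
  ∀ᵐ X ∂(averagedLaw μ), Tendsto (fun n => height u (X n)) atTop atTop

/-- The first regeneration time in direction `u`: the first time `n ≥ 1` with
`sup_{m < n} X_m · u < X_n · u = inf_{m ≥ n} X_m · u`, and `∞` if there is none. -/
noncomputable def regenTime {d : ℕ} (u : EuclideanSpace ℝ (Fin d)) (X : Path d) : ℕ∞ :=
  ⨅ (n : ℕ) (_ : 1 ≤ n ∧ (∀ m < n, height u (X m) < height u (X n)) ∧
    ∀ m ≥ n, height u (X n) ≤ height u (X m)), (n : ℕ∞)

/-- The first backtracking time in direction `u`: the first time `n ≥ 0` with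
`X_n · u < X_0 · u`, and `∞` if there is none. -/
noncomputable def backtrackTime {d : ℕ} (u : EuclideanSpace ℝ (Fin d)) (X : Path d) : ℕ∞ :=
  ⨅ (n : ℕ) (_ : height u (X n) < height u (X 0)), (n : ℕ∞)

/-- The moment `E₀(τ₁ ^ p)` of the first regeneration time in direction `u`, as an extended
nonnegative real; the value of the time may be infinite. -/
noncomputable def regenMoment {d : ℕ} (μ : Measure (JumpLaw d)) (u : EuclideanSpace ℝ (Fin d))
    (p : ℝ) : ℝ≥0∞ :=
  ∫⁻ X, (regenTime u X : ℝ≥0∞) ^ p ∂(averagedLaw μ)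

/-- The averaged law conditioned on the walk never backtracking in direction `w`. -/
noncomputable def noBacktrackLaw {d : ℕ} (μ : Measure (JumpLaw d))
    (w : EuclideanSpace ℝ (Fin d)) : Measure (Path d) :=
  ProbabilityTheory.cond (averagedLaw μ) {X | backtrackTime w X = ⊤}

/-- The velocity `v = E₀[X_σ | β = ∞] / E₀[σ | β = ∞]`, where `σ` and `β` are the first
regeneration time and the first backtracking time in direction `w`. -/
noncomputable def velocity {d : ℕ} (μ : Measure (JumpLaw d))
    (w : EuclideanSpace ℝ (Fin d)) : EuclideanSpace ℝ (Fin d) :=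
  (∫ X, ((regenTime w X).toNat : ℝ) ∂(noBacktrackLaw μ w))⁻¹ •
    ∫ X, toVec (X (regenTime w X).toNat) ∂(noBacktrackLaw μ w)

end RWRE

/-! Cut the walk at its regeneration times in direction `w`. A strict record followed by a future
that never goes below it separates the lattice into two disjoint sets of visited sites, so
independence and stationarity of the environment make past and future independent
(`averagedLaw_inter_shift_noBack`). Hence all blocks after the first are i.i.d. with the law
`noBacktrackLaw` of the first block of a walk that never backtracks (`averagedLaw_iterate_next`,
`noBacktrackLaw_block_inter`).

Since `u · v > 0`, for small `c` the advance of a block in direction `u` minus `2c` times its length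
has positive mean. At scale `N` consider times of order `N ^ 4`. A union bound with the moment of
order `p₃` makes every relevant block shorter than `N ^ 2`, outside probability `O(N ^ (4 - 2 p₃))`.
For blocks truncated at `N ^ 2`, an exponential moment with parameter of order `N ^ (-2)` is at most
`1`, so a drift sum below `-N ^ 3` costs `exp (-N / C)`. Thus `bad` has summable probability, even
with polynomial weights (`summable_averagedLaw_bad`).

If all scales from `N` on are good, the height in direction `u` grows at rate `c` after a lag `A * N
^ 3`, starting from any time up to `N ^ 4` (`height_growth_of_forall_notMem_bad`). Borel–Cantelli
then gives transience, which in turn makes the probability `ρ` of never backtracking in direction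
`u` positive.

On such a good path, failed attempts to regenerate in direction `u` succeed one another within `R *
N ^ 3` steps, so about `N / R` of them fit before `N ^ 4`. Attempts occur at records, so by the same
independence each fails with probability `1 - ρ`. Therefore `P₀(τ₁ > N ^ 4)` is at most a tail sum
of bad probabilities plus a geometric term (`averagedLaw_regenTime_gt_le`), and summation against `N
^ (4p)` gives the moment. -/

namespace RWRE

/-! ### Cylinder probabilities, stationarity and independence of the environment. -/

/-- The paths that agree with `h` up to time `n`. -/
def cyl {d : ℕ} (h : Path d) (n : ℕ) : Set (Path d) := {X | ∀ i ≤ n, X i = h i}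

theorem measurableSet_cyl {d : ℕ} (h : Path d) (n : ℕ) : MeasurableSet (cyl h n) := by
  have : cyl h n = ⋂ i : ℕ, ⋂ _ : i ≤ n, {X : Path d | X i = h i} := by
    ext X; simp [cyl]
  rw [this]
  exact MeasurableSet.iInter fun i => MeasurableSet.iInter fun _ =>
    measurableSet_eq_fun (measurable_pi_apply i) measurable_const

/-- The quenched probability of following `h` for `n` steps. -/
noncomputable def weight {d : ℕ} (ω : Env d) (h : Path d) (n : ℕ) : ℝ≥0∞ :=
  ∏ i ∈ Finset.range n, ω (h i) (h (i + 1) - h i)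

theorem partialTraj_singleton {d : ℕ} (x : Site d) (ω : Env d) (h : Path d) (n : ℕ) :
    Kernel.partialTraj (X := fun _ => Site d) (stepKernel ω) 0 n (fun _ => x)
      {Preorder.frestrictLe n h} = if h 0 = x then weight ω h n else 0 := by
  induction n with
  | zero =>
    rw [Kernel.partialTraj_self, Kernel.id_apply, Measure.dirac_apply, Set.indicator_apply]
    have : (fun _ : Finset.Iic 0 => x) ∈ ({Preorder.frestrictLe 0 h} : Set _) ↔ h 0 = x := by
      rw [Set.mem_singleton_iff]
      constructor
      · intro H
        exact (congrFun H ⟨0, Finset.mem_Iic.2 le_rfl⟩).symm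
      · rintro rfl
        funext i
        have : i.1 = 0 := Nat.le_zero.1 (Finset.mem_Iic.1 i.2)
        simp [this]
    simp [this, weight]
  | succ n ih =>
    have key : ∀ g : Finset.Iic n → Site d,
        Kernel.partialTraj (X := fun _ => Site d) (stepKernel ω) n (n + 1) g
          {Preorder.frestrictLe (n + 1) h} =
        Set.indicator {Preorder.frestrictLe n h}
          (fun _ => ω (h n) (h (n + 1) - h n)) g := by
      intro g
      rw [Kernel.partialTraj_succ_self]
      refine (Kernel.map_apply' _ (measurable_IicProdIoc (X := fun _ => Site d)) _
          MeasurableSet.of_discrete).trans ?_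
      rw [Kernel.prod_apply, Kernel.id_apply,
          Measure.prod_apply MeasurableSet.of_discrete, lintegral_dirac,
          Kernel.map_apply' _ (MeasurableEquiv.measurable _) _ MeasurableSet.of_discrete]
      by_cases hg : g = Preorder.frestrictLe n h
      · subst hg
        simp only [Set.mem_singleton_iff, Set.indicator_of_mem]
        have : ((MeasurableEquiv.piSingleton (X := fun _ => Site d) n) ⁻¹'
            (Prod.mk (Preorder.frestrictLe n h) ⁻¹'
              (IicProdIoc (X := fun _ => Site d) n (n + 1) ⁻¹'
                {Preorder.frestrictLe (n + 1) h}))) = {h (n + 1)} := by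
          ext z
          simp only [Set.mem_preimage, Set.mem_singleton_iff]
          constructor
          · intro H
            have := congrFun H ⟨n + 1, Finset.mem_Iic.2 le_rfl⟩
            simpa [IicProdIoc, MeasurableEquiv.piSingleton] using this
          · rintro rfl
            funext i
            by_cases hi : i.1 ≤ n
            · simp [IicProdIoc, hi]
            · have hi' : i.1 = n + 1 := le_antisymm (Finset.mem_Iic.1 i.2) (by omega)
              obtain ⟨i, hmem⟩ := i
              simp only at hi'
              subst hi'
              simp [IicProdIoc, MeasurableEquiv.piSingleton]
        rw [this]
        change (Measure.map _ _) _ = _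
        rw [Measure.map_apply Measurable.of_discrete MeasurableSet.of_discrete]
        have h2 : ((fun z => Preorder.frestrictLe n h ⟨n, Finset.mem_Iic.2 le_rfl⟩ + z) ⁻¹'
            {h (n + 1)} : Set (Site d)) = {h (n + 1) - h n} := by
          ext z
          simp only [Set.mem_preimage, Set.mem_singleton_iff, eq_sub_iff_add_eq']
          rfl
        rw [h2, PMF.toMeasure_apply_singleton _ _ MeasurableSet.of_discrete]
        rfl
      · rw [Set.indicator_of_notMem (by simpa using hg)]
        have : ((MeasurableEquiv.piSingleton (X := fun _ => Site d) n) ⁻¹'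
            (Prod.mk g ⁻¹'
              (IicProdIoc (X := fun _ => Site d) n (n + 1) ⁻¹'
                {Preorder.frestrictLe (n + 1) h}))) = ∅ := by
          rw [Set.eq_empty_iff_forall_notMem]
          intro z hz
          apply hg
          funext i
          have hi : i.1 ≤ n := Finset.mem_Iic.1 i.2
          have := congrFun hz ⟨i.1, Finset.mem_Iic.2 (hi.trans (Nat.le_succ n))⟩
          simpa [IicProdIoc, hi] using this
        rw [this, measure_empty]
    rw [Kernel.partialTraj_succ_eq_comp (Nat.zero_le n),
        Kernel.comp_apply' _ _ _ MeasurableSet.of_discrete]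
    simp_rw [key]
    rw [lintegral_indicator MeasurableSet.of_discrete, setLIntegral_const, ih]
    split_ifs
    · rw [weight, weight, Finset.prod_range_succ, mul_comm]
    · simp

theorem quenchedLaw_cyl {d : ℕ} (x : Site d) (ω : Env d) (h : Path d) (n : ℕ) :
    quenchedLaw x ω (cyl h n) = if h 0 = x then weight ω h n else 0 := by
  have : cyl h n = Preorder.frestrictLe (π := fun _ => Site d) n ⁻¹'
      {Preorder.frestrictLe n h} := by
    ext X
    simp only [cyl, Set.mem_ofPred_eq, Set.mem_preimage, Set.mem_singleton_iff]
    constructor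
    · intro H
      funext i
      exact H i (Finset.mem_Iic.1 i.2)
    · intro H i hi
      exact congrFun H ⟨i, Finset.mem_Iic.2 hi⟩
  rw [this, ← partialTraj_singleton x ω h n, ← Kernel.traj_map_frestrictLe_apply,
    Measure.map_apply (Preorder.measurable_frestrictLe n) MeasurableSet.of_discrete]
  rfl

theorem measurable_jumpLaw_apply {d : ℕ} (z : Site d) : Measurable fun p : JumpLaw d => p z :=
  (measurable_pi_apply z).comp (comap_measurable _)

theorem measurable_weight {d : ℕ} (h : Path d) (n : ℕ) :
    Measurable fun ω : Env d => weight ω h n :=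
  Finset.measurable_prod _ fun i _ =>
    (measurable_jumpLaw_apply _).comp (measurable_pi_apply (h i))

instance instIsProbabilityMeasureEnvLaw {d : ℕ} (μ : Measure (JumpLaw d))
    [IsProbabilityMeasure μ] : IsProbabilityMeasure (envLaw μ) := by
  unfold envLaw; infer_instance

theorem averagedLaw_apply {d : ℕ} (μ : Measure (JumpLaw d)) {s : Set (Path d)}
    (hs : MeasurableSet s) : averagedLaw μ s = ∫⁻ ω, quenchedLaw 0 ω s ∂envLaw μ :=
  Measure.bind_apply hs (measurable_quenchedLaw 0).aemeasurable

instance instIsProbabilityMeasureAveragedLaw {d : ℕ} (μ : Measure (JumpLaw d))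
    [IsProbabilityMeasure μ] : IsProbabilityMeasure (averagedLaw μ) :=
  ⟨by rw [averagedLaw_apply μ MeasurableSet.univ]; simp⟩

theorem averagedLaw_cyl {d : ℕ} (μ : Measure (JumpLaw d)) (h : Path d) (n : ℕ) :
    averagedLaw μ (cyl h n) = if h 0 = 0 then ∫⁻ ω, weight ω h n ∂envLaw μ else 0 := by
  rw [averagedLaw_apply μ (measurableSet_cyl h n)]
  simp_rw [quenchedLaw_cyl]
  split_ifs <;> simp

theorem weight_le_one {d : ℕ} (ω : Env d) (h : Path d) (n : ℕ) : weight ω h n ≤ 1 :=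
  Finset.prod_le_one' fun _ _ => PMF.coe_le_one _ _

theorem weight_add {d : ℕ} (ω : Env d) (h : Path d) (n k : ℕ) :
    weight ω h (n + k) = weight ω h n * weight ω (fun i => h (n + i)) k := by
  simp only [weight, Finset.prod_range_add, add_assoc]

/-- An i.i.d. environment is stationary under lattice translations. -/
theorem lintegral_weight_translate {d : ℕ} (μ : Measure (JumpLaw d)) [IsProbabilityMeasure μ]
    (a : Site d) (h : Path d) (n : ℕ) :
    ∫⁻ ω, weight ω (fun i => a + h i) n ∂envLaw μ = ∫⁻ ω, weight ω h n ∂envLaw μ := by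
  have hmap : (envLaw μ).map (fun ω : Env d => fun x => ω (a + x)) = envLaw μ := by
    refine Measure.eq_infinitePi _ fun s t ht => ?_
    rw [Measure.map_apply (by fun_prop) (MeasurableSet.pi s.countable_toSet fun i _ => ht i)]
    have : (fun ω : Env d => fun x => ω (a + x)) ⁻¹' (Set.pi s t) =
        Set.pi (s.map (addLeftEmbedding a) : Finset (Site d)) (fun x => t (x - a)) := by
      ext ω
      simp only [Set.mem_preimage, Set.mem_pi, Finset.mem_coe, Finset.mem_map,
        addLeftEmbedding_apply, forall_exists_index, and_imp]
      constructor
      · rintro H _ i hi rfl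
        simpa using H i hi
      · intro H i hi
        simpa using H _ i hi rfl
    rw [this, envLaw, Measure.infinitePi_pi _ (fun i _ => ht _), Finset.prod_map]
    simp
  conv_rhs => rw [← hmap]
  rw [lintegral_map (measurable_weight h n) (by fun_prop)]
  simp [weight]

/-- A weight only sees the environment at the sites from which a jump is made. The endpoints `h n`
and `g k` do not count, so the first path may end where the second one starts. -/
theorem lintegral_weight_mul {d : ℕ} (μ : Measure (JumpLaw d)) [IsProbabilityMeasure μ]
    (h g : Path d) (n k : ℕ) (hd : ∀ i < n, ∀ j < k, h i ≠ g j) :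
    ∫⁻ ω, weight ω h n * weight ω g k ∂envLaw μ =
      (∫⁻ ω, weight ω h n ∂envLaw μ) * ∫⁻ ω, weight ω g k ∂envLaw μ := by
  classical
  have hI : iIndepFun (fun (x : Site d) (ω : Env d) => ω x) (envLaw μ) := by
    simpa [envLaw] using iIndepFun_infinitePi (P := fun _ : Site d => μ)
      (X := fun _ : Site d => (id : JumpLaw d → JumpLaw d)) (fun _ => measurable_id)
  have hW : ∀ (h : Path d) (n : ℕ), ∃ F : (((Finset.range n).image h : Finset (Site d)) →
      JumpLaw d) → ℝ≥0∞, Measurable F ∧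
      ∀ ω : Env d, weight ω h n = F (fun x => ω x) := by
    intro h n
    refine ⟨fun ω => ∏ i ∈ (Finset.range n).attach,
      ω ⟨h i, Finset.mem_image_of_mem h i.2⟩ (h (i + 1) - h i), ?_, fun ω => ?_⟩
    · exact Finset.measurable_prod _ fun i _ =>
        (measurable_jumpLaw_apply _).comp (measurable_pi_apply _)
    · rw [weight, ← Finset.prod_attach]
  obtain ⟨F, hF, hF'⟩ := hW h n
  obtain ⟨G, hG, hG'⟩ := hW g k
  have hdis : Disjoint ((Finset.range n).image h) ((Finset.range k).image g) := by
    rw [Finset.disjoint_left]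
    intro x hx hx'
    obtain ⟨i, hi, rfl⟩ := Finset.mem_image.1 hx
    obtain ⟨j, hj, hij⟩ := Finset.mem_image.1 hx'
    exact hd i (Finset.mem_range.1 hi) j (Finset.mem_range.1 hj) hij.symm
  have hind := (hI.indepFun_finset _ _ hdis (fun x => measurable_pi_apply x)).comp hF hG
  have := lintegral_mul_eq_lintegral_mul_lintegral_of_indepFun (μ := envLaw μ)
    (f := fun ω => weight ω h n) (g := fun ω => weight ω g k)
    (measurable_weight h n) (measurable_weight g k) (by
      convert hind using 1
      · funext ω; exact hF' ω
      · funext ω; exact hG' ω)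
  exact this

/-! ### Events decided in finite time and comparison of path measures. -/

/-- Membership in `D` is decided by the path up to time `n`. -/
def DependsUpTo {d : ℕ} (n : ℕ) (D : Set (Path d)) : Prop :=
  ∀ X ∈ D, ∀ Y : Path d, (∀ i ≤ n, Y i = X i) → Y ∈ D

theorem DependsUpTo.mono {d n k : ℕ} {D : Set (Path d)} (hD : DependsUpTo n D) (hnk : n ≤ k) :
    DependsUpTo k D :=
  fun X hX Y hY => hD X hX Y fun i hi => hY i (hi.trans hnk)

theorem DependsUpTo.inter {d n : ℕ} {D E : Set (Path d)} (hD : DependsUpTo n D)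
    (hE : DependsUpTo n E) : DependsUpTo n (D ∩ E) :=
  fun X hX Y hY => ⟨hD X hX.1 Y hY, hE X hX.2 Y hY⟩

theorem DependsUpTo.eq_preimage {d n : ℕ} {D : Set (Path d)} (hD : DependsUpTo n D) :
    D = Preorder.frestrictLe (π := fun _ => Site d) n ⁻¹'
      (Preorder.frestrictLe (π := fun _ => Site d) n '' D) := by
  ext X
  constructor
  · exact fun hX => ⟨X, hX, rfl⟩
  · rintro ⟨Y, hY, hXY⟩
    refine hD Y hY X fun i hi => ?_
    exact (congrFun hXY ⟨i, Finset.mem_Iic.2 hi⟩).symm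

theorem DependsUpTo.measurableSet {d n : ℕ} {D : Set (Path d)} (hD : DependsUpTo n D) :
    MeasurableSet D := by
  rw [hD.eq_preimage]
  exact Preorder.measurable_frestrictLe n MeasurableSet.of_discrete

theorem preimage_frestrictLe_singleton {d : ℕ} (h : Path d) (n : ℕ) :
    Preorder.frestrictLe (π := fun _ => Site d) n ⁻¹' {Preorder.frestrictLe n h} = cyl h n := by
  ext X
  simp only [cyl, Set.mem_ofPred_eq, Set.mem_preimage, Set.mem_singleton_iff]
  constructor
  · intro H i hi
    exact congrFun H ⟨i, Finset.mem_Iic.2 hi⟩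
  · intro H
    funext i
    exact H i (Finset.mem_Iic.1 i.2)

/-- There are only countably many path segments of a given length, so `D` is a countable disjoint
union of cylinders. -/
theorem measure_le_of_cyl {d n : ℕ} (ν₁ ν₂ : Measure (Path d)) {D : Set (Path d)}
    (hD : DependsUpTo n D) (h : ∀ g ∈ D, ν₁ (cyl g n) ≤ ν₂ (cyl g n)) : ν₁ D ≤ ν₂ D := by
  have hm := Preorder.measurable_frestrictLe (X := fun _ => Site d) n
  have key : ∀ ν : Measure (Path d), ν D =
      ∑' r, (Preorder.frestrictLe (π := fun _ => Site d) n '' D).indicator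
        (fun r => ν.map (Preorder.frestrictLe (π := fun _ => Site d) n) {r}) r := by
    intro ν
    rw [Measure.tsum_indicator_apply_singleton _ _ MeasurableSet.of_discrete,
      Measure.map_apply hm MeasurableSet.of_discrete, ← hD.eq_preimage]
  rw [key ν₁, key ν₂]
  refine ENNReal.tsum_le_tsum fun r => ?_
  by_cases hr : r ∈ Preorder.frestrictLe (π := fun _ => Site d) n '' D
  · obtain ⟨g, hg, rfl⟩ := hr
    have hmem := Set.mem_image_of_mem (Preorder.frestrictLe (π := fun _ => Site d) n) hg
    simp only [Set.indicator_of_mem hmem]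
    rw [Measure.map_apply hm MeasurableSet.of_discrete,
      Measure.map_apply hm MeasurableSet.of_discrete, preimage_frestrictLe_singleton]
    exact h g hg
  · simp [Set.indicator_of_notMem hr]

theorem measure_eq_of_cyl {d n : ℕ} (ν₁ ν₂ : Measure (Path d)) {D : Set (Path d)}
    (hD : DependsUpTo n D) (h : ∀ g ∈ D, ν₁ (cyl g n) = ν₂ (cyl g n)) : ν₁ D = ν₂ D :=
  le_antisymm (measure_le_of_cyl ν₁ ν₂ hD fun g hg => (h g hg).le)
    (measure_le_of_cyl ν₂ ν₁ hD fun g hg => (h g hg).ge)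

theorem height_add {d : ℕ} (u : EuclideanSpace ℝ (Fin d)) (x y : Site d) :
    height u (x + y) = height u x + height u y := by
  have : toVec (x + y) = toVec x + toVec y := by
    ext i; simp [toVec]
  rw [height, this, inner_add_left]; rfl

@[simp] theorem height_zero {d : ℕ} (u : EuclideanSpace ℝ (Fin d)) : height u (0 : Site d) = 0 := by
  simpa using height_add u 0 0

theorem height_sub {d : ℕ} (u : EuclideanSpace ℝ (Fin d)) (x y : Site d) :
    height u (x - y) = height u x - height u y := by
  have := height_add u (x - y) y
  rw [sub_add_cancel] at this
  linarith

/-- The paths that stay above their starting height up to time `k`. -/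
def noBackUpTo {d : ℕ} (u : EuclideanSpace ℝ (Fin d)) (k : ℕ) : Set (Path d) :=
  {X | ∀ j ≤ k, height u (X 0) ≤ height u (X j)}

/-- The paths that never go below their starting height. -/
def noBack {d : ℕ} (u : EuclideanSpace ℝ (Fin d)) : Set (Path d) :=
  {X | ∀ j, height u (X 0) ≤ height u (X j)}

theorem dependsUpTo_noBackUpTo {d : ℕ} (u : EuclideanSpace ℝ (Fin d)) (k : ℕ) :
    DependsUpTo k (noBackUpTo u k) := by
  intro X hX Y hY j hj
  rw [hY j hj, hY 0 (Nat.zero_le _)]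
  exact hX j hj

theorem noBack_eq_iInter {d : ℕ} (u : EuclideanSpace ℝ (Fin d)) :
    noBack u = ⋂ k, noBackUpTo u k := by
  ext X
  simp only [noBack, noBackUpTo, Set.mem_ofPred_eq, Set.mem_iInter]
  exact ⟨fun H k j _ => H j, fun H j => H j j le_rfl⟩

theorem measurableSet_noBack {d : ℕ} (u : EuclideanSpace ℝ (Fin d)) :
    MeasurableSet (noBack u) := by
  rw [noBack_eq_iInter]
  exact MeasurableSet.iInter fun k => (dependsUpTo_noBackUpTo u k).measurableSet

/-- Because `noBack` is the decreasing limit of the events `noBackUpTo u k`, a comparison is needed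
only on cylinders that have not yet backtracked. Those are the cylinders on which independence from
the past is available. -/
theorem measure_noBack_inter_le {d : ℕ} (u : EuclideanSpace ℝ (Fin d))
    (ν₁ ν₂ : Measure (Path d)) [IsFiniteMeasure ν₁] [IsFiniteMeasure ν₂]
    (h : ∀ k, ∀ g ∈ noBackUpTo u k, ν₁ (cyl g k) ≤ ν₂ (cyl g k))
    {j : ℕ} {D : Set (Path d)} (hD : DependsUpTo j D) :
    ν₁ (noBack u ∩ D) ≤ ν₂ (noBack u ∩ D) := by
  have hlim : ∀ (ν : Measure (Path d)) [IsFiniteMeasure ν],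
      Tendsto (fun k => ν (noBackUpTo u k ∩ D)) atTop (𝓝 (ν (noBack u ∩ D))) := by
    intro ν _
    have : noBack u ∩ D = ⋂ k, (noBackUpTo u k ∩ D) := by
      rw [noBack_eq_iInter, Set.iInter_inter]
    rw [this]
    refine tendsto_measure_iInter_atTop
      (fun k => ((dependsUpTo_noBackUpTo u k).measurableSet.inter
        hD.measurableSet).nullMeasurableSet) ?_ ⟨0, measure_ne_top _ _⟩
    intro k l hkl X hX
    exact ⟨fun i hi => hX.1 i (hi.trans hkl), hX.2⟩
  refine le_of_tendsto_of_tendsto (hlim ν₁) (hlim ν₂) ?_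
  filter_upwards [eventually_ge_atTop j] with k hk
  exact measure_le_of_cyl ν₁ ν₂ ((dependsUpTo_noBackUpTo u k).inter (hD.mono hk))
    fun g hg => h k g hg.1

theorem generateFrom_dependsUpTo (d : ℕ) :
    (inferInstance : MeasurableSpace (Path d)) =
      MeasurableSpace.generateFrom {D | ∃ n, DependsUpTo n D} := by
  apply le_antisymm
  · refine iSup_le fun i => ?_
    rw [MeasurableSpace.comap_le_iff_le_map]
    intro S _
    refine MeasurableSpace.measurableSet_generateFrom ⟨i, fun X hX Y hY => ?_⟩
    simp only [Set.mem_preimage] at hX ⊢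
    rwa [hY i le_rfl]
  · refine MeasurableSpace.generateFrom_le ?_
    rintro D ⟨n, hD⟩
    exact hD.measurableSet

theorem measure_noBack_inter_eq {d : ℕ} (u : EuclideanSpace ℝ (Fin d))
    (ν₁ ν₂ : Measure (Path d)) [IsFiniteMeasure ν₁] [IsFiniteMeasure ν₂]
    (h : ∀ k, ∀ g ∈ noBackUpTo u k, ν₁ (cyl g k) = ν₂ (cyl g k))
    {B : Set (Path d)} (hB : MeasurableSet B) : ν₁ (noBack u ∩ B) = ν₂ (noBack u ∩ B) := by
  have hD : ∀ D : Set (Path d), (∃ n, DependsUpTo n D) →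
      ν₁ (noBack u ∩ D) = ν₂ (noBack u ∩ D) := by
    rintro D ⟨n, hD⟩
    exact le_antisymm (measure_noBack_inter_le u ν₁ ν₂ (fun k g hg => (h k g hg).le) hD)
      (measure_noBack_inter_le u ν₂ ν₁ (fun k g hg => (h k g hg).ge) hD)
  have : ν₁.restrict (noBack u) = ν₂.restrict (noBack u) := by
    refine ext_of_generate_finite {D | ∃ n, DependsUpTo n D} (generateFrom_dependsUpTo d) ?_ ?_ ?_
    · rintro D ⟨n, hD⟩ E ⟨k, hE⟩ _
      exact ⟨max n k, (hD.mono (le_max_left n k)).inter (hE.mono (le_max_right n k))⟩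
    · rintro D ⟨n, hDn⟩
      rw [Measure.restrict_apply hDn.measurableSet, Measure.restrict_apply hDn.measurableSet,
        Set.inter_comm]
      exact hD D ⟨n, hDn⟩
    · simpa using hD Set.univ ⟨0, fun _ _ _ _ => trivial⟩
  have h2 := congrArg (fun ν => ν B) this
  simpa only [Measure.restrict_apply hB, Set.inter_comm] using h2

/-! ### Independence at records and positivity of the no-backtracking probability. -/

/-- The path after time `n`, recentred at the origin. -/
def shift {d : ℕ} (n : ℕ) (X : Path d) : Path d := fun l => X (n + l) - X n

theorem measurable_shift {d : ℕ} (n : ℕ) : Measurable (shift (d := d) n) :=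
  measurable_pi_lambda _ fun l => (measurable_pi_apply (n + l)).sub (measurable_pi_apply n)

/-- The strict record property at time `n` in direction `u`. -/
def record {d : ℕ} (u : EuclideanSpace ℝ (Fin d)) (n : ℕ) : Set (Path d) :=
  {X | ∀ m < n, height u (X m) < height u (X n)}

theorem dependsUpTo_record {d : ℕ} (u : EuclideanSpace ℝ (Fin d)) (n : ℕ) :
    DependsUpTo n (record u n) := by
  intro X hX Y hY m hm
  rw [hY m hm.le, hY n le_rfl]
  exact hX m hm

theorem averagedLaw_cyl_inter_shift {d : ℕ} (μ : Measure (JumpLaw d)) (h g : Path d) (n k : ℕ)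
    (h0 : h 0 = 0) (g0 : g 0 = 0) :
    averagedLaw μ (cyl h n ∩ shift n ⁻¹' cyl g k) =
      ∫⁻ ω, weight ω h n * weight ω (fun i => h n + g i) k ∂envLaw μ := by
  set c : Path d := fun i => if i ≤ n then h i else h n + g (i - n) with hc
  have c1 : ∀ i ≤ n, c i = h i := fun i hi => by simp [hc, hi]
  have c2 : ∀ i, c (n + i) = h n + g i := by
    intro i
    rcases Nat.eq_zero_or_pos i with rfl | hi
    · simp [c1 n le_rfl, g0]
    · simp [hc, hi.ne']
  have hset : cyl h n ∩ shift n ⁻¹' cyl g k = cyl c (n + k) := by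
    ext X
    simp only [cyl, shift, Set.mem_inter_iff, Set.mem_preimage, Set.mem_ofPred_eq]
    constructor
    · rintro ⟨H1, H2⟩ i hi
      rcases le_total i n with hin | hin
      · rw [c1 i hin, H1 i hin]
      · obtain ⟨j, rfl⟩ := Nat.exists_eq_add_of_le hin
        rw [c2, ← H2 j (by omega), H1 n le_rfl]
        abel
    · intro H
      have H1 : ∀ i ≤ n, X i = h i := fun i hi => by rw [H i (by omega), c1 i hi]
      refine ⟨H1, fun j hj => ?_⟩
      rw [H (n + j) (by omega), c2, H1 n le_rfl]
      abel
  rw [hset, averagedLaw_cyl, if_pos (by rw [c1 0 (Nat.zero_le _), h0])]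
  refine lintegral_congr fun ω => ?_
  rw [weight_add]
  congr 1
  · refine Finset.prod_congr rfl fun i hi => ?_
    have := Finset.mem_range.1 hi
    rw [c1 i this.le, c1 (i + 1) this]
  · congr 1
    funext i
    exact c2 i

theorem averagedLaw_cyl_inter_shift_of_ne {d : ℕ} (μ : Measure (JumpLaw d)) (h g : Path d)
    (n k : ℕ) (H : h 0 ≠ 0 ∨ g 0 ≠ 0) :
    averagedLaw μ (cyl h n ∩ shift n ⁻¹' cyl g k) = 0 := by
  rcases H with H | H
  · refine measure_mono_null Set.inter_subset_left ?_
    rw [averagedLaw_cyl, if_neg H]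
  · have : cyl h n ∩ shift n ⁻¹' cyl g k = ∅ := by
      rw [Set.eq_empty_iff_forall_notMem]
      rintro X ⟨_, hX⟩
      have := hX 0 (Nat.zero_le _)
      simp only [shift, add_zero, sub_self] at this
      exact H this.symm
    rw [this, measure_empty]

/-- The averaged walk is not Markov. The product form holds because, at a record followed by no
backtracking, past and future use the environment at disjoint sets of sites. -/
theorem averagedLaw_cyl_inter_shift_noBack {d : ℕ} (μ : Measure (JumpLaw d))
    [IsProbabilityMeasure μ] (u : EuclideanSpace ℝ (Fin d)) {h : Path d} {n : ℕ}
    (hh : h ∈ record u n) {B : Set (Path d)} (hB : MeasurableSet B) :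
    averagedLaw μ (cyl h n ∩ shift n ⁻¹' (noBack u ∩ B)) =
      averagedLaw μ (cyl h n) * averagedLaw μ (noBack u ∩ B) := by
  have := Measure.smul_finite (averagedLaw μ) (measure_ne_top (averagedLaw μ) (cyl h n))
  have key := measure_noBack_inter_eq u
    (((averagedLaw μ).restrict (cyl h n)).map (shift n))
    (averagedLaw μ (cyl h n) • averagedLaw μ) ?_ hB
  · rw [Measure.map_apply (measurable_shift n) ((measurableSet_noBack u).inter hB),
      Measure.restrict_apply ((measurable_shift n) ((measurableSet_noBack u).inter hB)),
      Set.inter_comm] at key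
    simpa using key
  · intro k g hg
    rw [Measure.map_apply (measurable_shift n) (measurableSet_cyl g k),
      Measure.restrict_apply (measurable_shift n (measurableSet_cyl g k)), Set.inter_comm,
      Measure.smul_apply, smul_eq_mul]
    by_cases H : h 0 = 0 ∧ g 0 = 0
    · rw [averagedLaw_cyl_inter_shift μ h g n k H.1 H.2, lintegral_weight_mul,
        lintegral_weight_translate, averagedLaw_cyl, averagedLaw_cyl, if_pos H.1, if_pos H.2]
      -- The sites left before time `n` lie strictly below the record level and the later ones lie
      -- at or above it. Strictness of the record is what rules out a common site.
      intro i hi j hj hij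
      have h1 := hh i hi
      have h2 := hg j hj.le
      rw [hij, height_add] at h1
      simp only [H.2, height_zero] at h2
      linarith
    · rw [averagedLaw_cyl_inter_shift_of_ne μ h g n k (by tauto), averagedLaw_cyl, averagedLaw_cyl]
      by_cases h0 : h 0 = 0
      · rw [if_neg (c := g 0 = 0) (by tauto), mul_zero]
      · rw [if_neg h0, zero_mul]

/-- Independence of the past of a record and of the future that stays above it. -/
theorem averagedLaw_inter_shift_noBack {d : ℕ} (μ : Measure (JumpLaw d))
    [IsProbabilityMeasure μ] (u : EuclideanSpace ℝ (Fin d)) {n : ℕ} {D : Set (Path d)}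
    (hD : DependsUpTo n D) (hr : D ⊆ record u n) {B : Set (Path d)} (hB : MeasurableSet B) :
    averagedLaw μ (D ∩ shift n ⁻¹' (noBack u ∩ B)) =
      averagedLaw μ D * averagedLaw μ (noBack u ∩ B) := by
  have := measure_eq_of_cyl ((averagedLaw μ).restrict (shift n ⁻¹' (noBack u ∩ B)))
    (averagedLaw μ (noBack u ∩ B) • averagedLaw μ) hD ?_
  · rw [Measure.restrict_apply hD.measurableSet] at this
    rw [this, Measure.smul_apply, smul_eq_mul, mul_comm]
  · intro g hg
    rw [Measure.restrict_apply (measurableSet_cyl g n),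
      averagedLaw_cyl_inter_shift_noBack μ u (hr hg) hB, Measure.smul_apply, smul_eq_mul, mul_comm]

/-- An arbitrary time `n` need not be a record, so independence fails. An inequality suffices:
bounding the weight of the past by `1` and translating dominates the law of the future on each
cylinder by `averagedLaw μ`. -/
theorem averagedLaw_shift_noBack_eq_zero {d : ℕ} (μ : Measure (JumpLaw d))
    [IsProbabilityMeasure μ] (u : EuclideanSpace ℝ (Fin d))
    (h0 : averagedLaw μ (noBack u) = 0) (n : ℕ) :
    averagedLaw μ (shift n ⁻¹' noBack u) = 0 := by
  have huniv : DependsUpTo n (Set.univ : Set (Path d)) := fun _ _ _ _ => trivial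
  have := measure_le_of_cyl ((averagedLaw μ).restrict (shift n ⁻¹' noBack u)) 0 huniv ?_
  · simpa using this
  · intro h _
    rw [Measure.restrict_apply (measurableSet_cyl h n)]
    have key := measure_noBack_inter_le u
      (((averagedLaw μ).restrict (cyl h n)).map (shift n)) (averagedLaw μ) ?_
      (D := Set.univ) (j := 0) fun _ _ _ _ => trivial
    · rw [Set.inter_univ, h0, Measure.map_apply (measurable_shift n) (measurableSet_noBack u),
        Measure.restrict_apply (measurable_shift n (measurableSet_noBack u)),
        Set.inter_comm] at key
      exact key
    · intro k g _
      rw [Measure.map_apply (measurable_shift n) (measurableSet_cyl g k),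
        Measure.restrict_apply (measurable_shift n (measurableSet_cyl g k)), Set.inter_comm]
      by_cases H : h 0 = 0 ∧ g 0 = 0
      · rw [averagedLaw_cyl_inter_shift μ h g n k H.1 H.2, averagedLaw_cyl, if_pos H.2,
          ← lintegral_weight_translate μ (h n) g k]
        exact lintegral_mono fun ω => mul_le_of_le_one_left' (weight_le_one ω h n)
      · rw [averagedLaw_cyl_inter_shift_of_ne μ h g n k (by tauto)]
        exact zero_le

/-- A transient path attains its minimal height, and after a time of minimum it never backtracks. If
`noBack` were null, no time could have this property. -/
theorem averagedLaw_noBack_pos {d : ℕ} (μ : Measure (JumpLaw d)) [IsProbabilityMeasure μ]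
    (u : EuclideanSpace ℝ (Fin d)) (hu : TransientIn μ u) : 0 < averagedLaw μ (noBack u) := by
  rw [pos_iff_ne_zero]
  intro h0
  have h1 : ∀ᵐ X ∂averagedLaw μ, ∀ n, shift n X ∉ noBack u := by
    rw [ae_all_iff]
    intro n
    rw [ae_iff]
    simp only [not_not]
    exact averagedLaw_shift_noBack_eq_zero μ u h0 n
  obtain ⟨X, hX, hX'⟩ := (hu.and h1).exists
  obtain ⟨n, hn⟩ : ∃ n, ∀ m, height u (X n) ≤ height u (X m) := by
    rw [← Nat.cofinite_eq_atTop] at hX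
    exact hX.exists_forall_le
  refine hX' n fun j => ?_
  simp only [shift, height_sub, add_zero]
  linarith [hn (n + j)]

theorem ae_eq_zero_start {d : ℕ} (μ : Measure (JumpLaw d)) [IsProbabilityMeasure μ] :
    ∀ᵐ X ∂averagedLaw μ, X 0 = 0 := by
  have hD : DependsUpTo 0 {X : Path d | X 0 ≠ 0} := by
    intro X hX Y hY
    simp only [Set.mem_ofPred_eq] at hX ⊢
    rwa [hY 0 le_rfl]
  have := measure_le_of_cyl (averagedLaw μ) 0 hD fun g hg => by
    rw [averagedLaw_cyl, if_neg hg]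
    exact zero_le
  simpa [ae_iff] using this

theorem ae_bounded_steps {d : ℕ} (μ : Measure (JumpLaw d)) [IsProbabilityMeasure μ]
    (hs : BoundedSteps μ) : ∃ M : ℝ, 0 < M ∧ ∀ᵐ X ∂averagedLaw μ,
      ∀ n, ‖toVec (X (n + 1) - X n)‖ ≤ M := by
  obtain ⟨M, hM, hM'⟩ := hs
  refine ⟨M, hM, ae_all_iff.2 fun n => ?_⟩
  have hD : DependsUpTo (n + 1) {X : Path d | M < ‖toVec (X (n + 1) - X n)‖} := by
    intro X hX Y hY
    simp only [Set.mem_ofPred_eq] at hX ⊢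
    rwa [hY n (Nat.le_succ n), hY (n + 1) le_rfl]
  have := measure_le_of_cyl (averagedLaw μ) 0 hD fun g hg => by
    rw [averagedLaw_cyl]
    split_ifs
    · have hz := hM' _ hg
      -- The step bound is assumed at the origin only. It reaches the site `g n` through the common
      -- marginal `μ`.
      have hμ : ∀ᵐ p ∂μ, p (g (n + 1) - g n) = 0 := by
        have hmp := measurePreserving_eval_infinitePi (fun _ : Site d => μ) 0
        rw [← hmp.map_eq, ae_map_iff hmp.measurable.aemeasurable
            (measurableSet_eq_fun (measurable_jumpLaw_apply _) measurable_const)]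
        exact hz
      have hx : ∀ᵐ ω ∂envLaw μ, ω (g n) (g (n + 1) - g n) = 0 :=
        (measurePreserving_eval_infinitePi (fun _ : Site d => μ)
          (g n)).quasiMeasurePreserving.ae hμ
      rw [lintegral_eq_zero_iff (measurable_weight g (n + 1)) |>.2]
      · exact zero_le
      · filter_upwards [hx] with ω hω
        rw [weight, Finset.prod_range_succ, hω, mul_zero]
        rfl
    · exact zero_le
  simpa [ae_iff] using this

/-! ### Regeneration times and the law at the first of them. -/

/-- `n ≥ 1` is a regeneration time of the path `X` in direction `u`. -/
def IsRegen {d : ℕ} (u : EuclideanSpace ℝ (Fin d)) (n : ℕ) (X : Path d) : Prop :=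
  1 ≤ n ∧ (∀ m < n, height u (X m) < height u (X n)) ∧ ∀ m ≥ n, height u (X n) ≤ height u (X m)

theorem le_regenTime_iff {d : ℕ} (u : EuclideanSpace ℝ (Fin d)) (X : Path d) (N : ℕ∞) :
    N ≤ regenTime u X ↔ ∀ n, IsRegen u n X → N ≤ n := by
  simp [regenTime, IsRegen]

theorem regenTime_le {d : ℕ} {u : EuclideanSpace ℝ (Fin d)} {X : Path d} {n : ℕ}
    (h : IsRegen u n X) : regenTime u X ≤ n :=
  (le_regenTime_iff u X _).1 le_rfl n h

theorem regenTime_eq_coe_iff {d : ℕ} (u : EuclideanSpace ℝ (Fin d)) (X : Path d) (n : ℕ) :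
    regenTime u X = n ↔ IsRegen u n X ∧ ∀ m < n, ¬ IsRegen u m X := by
  constructor
  · intro h
    have hlt : ∀ m < n, ¬ IsRegen u m X := fun m hm hr => by
      have := regenTime_le hr
      rw [h] at this
      exact absurd hm (not_lt.2 (by exact_mod_cast this))
    refine ⟨?_, hlt⟩
    by_contra hn
    have : ((n + 1 : ℕ) : ℕ∞) ≤ regenTime u X := by
      rw [le_regenTime_iff]
      intro m hm
      have h1 : ¬ m < n := fun hmn => hlt m hmn hm
      have h2 : m ≠ n := fun hmn => hn (hmn ▸ hm)
      exact_mod_cast (by omega : n + 1 ≤ m)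
    rw [h, Nat.cast_le] at this
    omega
  · rintro ⟨h1, h2⟩
    refine le_antisymm (regenTime_le h1) ((le_regenTime_iff u X _).2 fun m hm => ?_)
    exact_mod_cast not_lt.1 fun hmn => h2 m hmn hm

theorem one_le_regenTime {d : ℕ} (u : EuclideanSpace ℝ (Fin d)) (X : Path d) :
    1 ≤ regenTime u X :=
  (le_regenTime_iff u X _).2 fun n hn => by exact_mod_cast hn.1

/-- The paths for which `n` is a record, and no earlier time is a regeneration time of the path
stopped at time `n`. -/
def preRegen {d : ℕ} (u : EuclideanSpace ℝ (Fin d)) (n : ℕ) : Set (Path d) :=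
  {X | (1 ≤ n ∧ X ∈ record u n) ∧ ∀ m < n, ¬ (1 ≤ m ∧ X ∈ record u m ∧
    ∀ j ≤ n, m ≤ j → height u (X m) ≤ height u (X j))}

theorem dependsUpTo_preRegen {d : ℕ} (u : EuclideanSpace ℝ (Fin d)) (n : ℕ) :
    DependsUpTo n (preRegen u n) := by
  rintro X ⟨⟨h1, h2⟩, h3⟩ Y hY
  refine ⟨⟨h1, dependsUpTo_record u n X h2 Y hY⟩, fun m hm H => h3 m hm ⟨H.1, ?_, ?_⟩⟩
  · exact dependsUpTo_record u m Y H.2.1 X fun i hi => (hY i (hi.trans hm.le)).symm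
  · intro j hj hmj
    have := H.2.2 j hj hmj
    rwa [hY m hm.le, hY j hj] at this

theorem preRegen_subset_record {d : ℕ} (u : EuclideanSpace ℝ (Fin d)) (n : ℕ) :
    preRegen u n ⊆ record u n := fun _ h => h.1.2

theorem mem_shift_noBack_iff {d : ℕ} (u : EuclideanSpace ℝ (Fin d)) (n : ℕ) (X : Path d) :
    shift n X ∈ noBack u ↔ ∀ m ≥ n, height u (X n) ≤ height u (X m) := by
  simp only [noBack, shift, Set.mem_ofPred_eq, height_sub, add_zero, sub_self,
    height_zero]
  constructor
  · intro H m hm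
    obtain ⟨j, rfl⟩ := Nat.exists_eq_add_of_le hm
    linarith [H j]
  · intro H j
    linarith [H (n + j) (Nat.le_add_right n j)]

/-- The event splits into one about the past and one about the future. If some `m < n` has not been
undercut by time `n`, it never will be, because the path stays above `X n` and `X n` is a strict
record. So failure of every earlier `m` is already visible at time `n`. -/
theorem setOf_regenTime_eq {d : ℕ} (u : EuclideanSpace ℝ (Fin d)) (n : ℕ) :
    {X : Path d | regenTime u X = n} = preRegen u n ∩ shift n ⁻¹' noBack u := by
  ext X
  simp only [Set.mem_ofPred_eq, regenTime_eq_coe_iff, Set.mem_inter_iff, Set.mem_preimage,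
    mem_shift_noBack_iff]
  constructor
  · rintro ⟨⟨h1, h2, h3⟩, h4⟩
    refine ⟨⟨⟨h1, h2⟩, fun m hm H => h4 m hm ⟨H.1, H.2.1, fun j hj => ?_⟩⟩, h3⟩
    rcases le_total j n with hjn | hjn
    · exact H.2.2 j hjn hj
    · exact (h2 m hm).le.trans (h3 j hjn)
  · rintro ⟨⟨⟨h1, h2⟩, h3⟩, h4⟩
    exact ⟨⟨h1, h2, h4⟩, fun m hm H => h3 m hm ⟨H.1, H.2.1, fun j _ hmj => H.2.2 j hmj⟩⟩

theorem measurableSet_regenTime_eq {d : ℕ} (u : EuclideanSpace ℝ (Fin d)) (n : ℕ) :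
    MeasurableSet {X : Path d | regenTime u X = n} := by
  rw [setOf_regenTime_eq]
  exact (dependsUpTo_preRegen u n).measurableSet.inter
    (measurable_shift n (measurableSet_noBack u))

theorem backtrackTime_eq_top_iff {d : ℕ} (w : EuclideanSpace ℝ (Fin d)) (X : Path d) :
    backtrackTime w X = ⊤ ↔ X ∈ noBack w := by
  simp [backtrackTime, noBack, iInf_eq_top]

theorem noBacktrackLaw_eq {d : ℕ} (μ : Measure (JumpLaw d)) (w : EuclideanSpace ℝ (Fin d)) :
    noBacktrackLaw μ w = ProbabilityTheory.cond (averagedLaw μ) (noBack w) := by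
  rw [noBacktrackLaw]
  congr 1
  ext X
  exact backtrackTime_eq_top_iff w X

theorem noBacktrackLaw_apply {d : ℕ} (μ : Measure (JumpLaw d)) (w : EuclideanSpace ℝ (Fin d))
    (B : Set (Path d)) :
    noBacktrackLaw μ w B = (averagedLaw μ (noBack w))⁻¹ * averagedLaw μ (noBack w ∩ B) := by
  rw [noBacktrackLaw_eq, cond_apply (measurableSet_noBack w)]

theorem isProbabilityMeasure_noBacktrackLaw {d : ℕ} (μ : Measure (JumpLaw d))
    [IsProbabilityMeasure μ] (w : EuclideanSpace ℝ (Fin d)) (hw : TransientIn μ w) :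
    IsProbabilityMeasure (noBacktrackLaw μ w) := by
  rw [noBacktrackLaw_eq]
  exact cond_isProbabilityMeasure (averagedLaw_noBack_pos μ w hw).ne'

theorem noBacktrackLaw_absolutelyContinuous {d : ℕ} (μ : Measure (JumpLaw d))
    (w : EuclideanSpace ℝ (Fin d)) : noBacktrackLaw μ w ≪ averagedLaw μ := by
  rw [noBacktrackLaw_eq]
  exact cond_absolutelyContinuous

theorem noBacktrackLaw_le {d : ℕ} (μ : Measure (JumpLaw d))
    (w : EuclideanSpace ℝ (Fin d)) :
    noBacktrackLaw μ w ≤ (averagedLaw μ (noBack w))⁻¹ • averagedLaw μ := by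
  refine Measure.le_iff.2 fun B _ => ?_
  rw [noBacktrackLaw_apply, Measure.smul_apply, smul_eq_mul]
  gcongr
  exact Set.inter_subset_right

theorem averagedLaw_regenTime_inter {d : ℕ} (μ : Measure (JumpLaw d)) [IsProbabilityMeasure μ]
    (w : EuclideanSpace ℝ (Fin d)) (hw : TransientIn μ w) {n : ℕ} {E : Set (Path d)}
    (hE : DependsUpTo n E) {B : Set (Path d)} (hB : MeasurableSet B) :
    averagedLaw μ ({X | regenTime w X = n} ∩ E ∩ shift n ⁻¹' B) =
      averagedLaw μ ({X | regenTime w X = n} ∩ E) * noBacktrackLaw μ w B := by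
  have h0 := (averagedLaw_noBack_pos μ w hw).ne'
  have hD := (dependsUpTo_preRegen w n).inter hE
  have hr : preRegen w n ∩ E ⊆ record w n :=
    Set.inter_subset_left.trans (preRegen_subset_record w n)
  have e1 : {X | regenTime w X = n} ∩ E ∩ shift n ⁻¹' B =
      (preRegen w n ∩ E) ∩ shift n ⁻¹' (noBack w ∩ B) := by
    rw [setOf_regenTime_eq, Set.preimage_inter]
    ext X; simp only [Set.mem_inter_iff]; tauto
  have e2 : {X | regenTime w X = n} ∩ E =
      (preRegen w n ∩ E) ∩ shift n ⁻¹' (noBack w ∩ Set.univ) := by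
    rw [setOf_regenTime_eq, Set.inter_univ]
    ext X; simp only [Set.mem_inter_iff]; tauto
  rw [e1, e2, averagedLaw_inter_shift_noBack μ w hD hr hB,
    averagedLaw_inter_shift_noBack μ w hD hr MeasurableSet.univ, noBacktrackLaw_apply,
    Set.inter_univ, mul_assoc, ← mul_assoc (averagedLaw μ (noBack w)),
    ENNReal.mul_inv_cancel h0 (measure_ne_top _ _), one_mul]

/-! ### Regeneration blocks. -/

/-- The length of the first regeneration block. -/
noncomputable def blockLen {d : ℕ} (w : EuclideanSpace ℝ (Fin d)) (X : Path d) : ℕ :=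
  (regenTime w X).toNat

/-- The path after its first regeneration time, recentred at the origin. -/
noncomputable def next {d : ℕ} (w : EuclideanSpace ℝ (Fin d)) (X : Path d) : Path d :=
  shift (blockLen w X) X

/-- The length of the first regeneration block and the site at its end. -/
noncomputable def block {d : ℕ} (w : EuclideanSpace ℝ (Fin d)) (X : Path d) : ℕ × Site d :=
  (blockLen w X, X (blockLen w X))

theorem regenTime_eq_iff_blockLen {d : ℕ} (w : EuclideanSpace ℝ (Fin d)) (X : Path d) {n : ℕ}
    (hn : n ≠ 0) : regenTime w X = n ↔ blockLen w X = n := by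
  rw [blockLen]
  cases h : regenTime w X with
  | top => simp [hn.symm]
  | coe k => simp

/-- Regeneration times are at least `1`, so the value `0` of `ENat.toNat` unambiguously encodes an
infinite time. -/
theorem regenTime_eq_top_iff_blockLen {d : ℕ} (w : EuclideanSpace ℝ (Fin d)) (X : Path d) :
    regenTime w X = ⊤ ↔ blockLen w X = 0 := by
  have := one_le_regenTime w X
  rw [blockLen, ENat.toNat_eq_zero]
  constructor
  · exact Or.inr
  · rintro (h | h)
    · simp [h] at this
    · exact h

theorem measurable_blockLen {d : ℕ} (w : EuclideanSpace ℝ (Fin d)) : Measurable (blockLen w) := by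
  have hpos : ∀ n ≠ 0, MeasurableSet (blockLen w ⁻¹' {n}) := by
    intro n hn
    convert measurableSet_regenTime_eq w n using 1
    ext X
    exact (regenTime_eq_iff_blockLen w X hn).symm
  refine measurable_to_countable' fun n => ?_
  by_cases hn : n = 0
  · have : blockLen w ⁻¹' {n} = (⋃ k : ℕ, blockLen w ⁻¹' {k + 1})ᶜ := by
      ext X
      simp only [hn, Set.mem_preimage, Set.mem_singleton_iff, Set.mem_compl_iff, Set.mem_iUnion]
      constructor
      · rintro h ⟨k, hk⟩; omega
      · intro h
        by_contra h'
        exact h ⟨blockLen w X - 1, by omega⟩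
    rw [this]
    exact (MeasurableSet.iUnion fun k => hpos _ (Nat.succ_ne_zero k)).compl
  · exact hpos n hn

theorem measurable_eval_of_countable {d : ℕ} {t : Path d → ℕ} (ht : Measurable t) :
    Measurable fun X : Path d => X (t X) := by
  have : Measurable fun q : Path d × ℕ => q.1 q.2 :=
    measurable_from_prod_countable_left fun n => measurable_pi_apply n
  exact this.comp (measurable_id.prodMk ht)

theorem measurable_next {d : ℕ} (w : EuclideanSpace ℝ (Fin d)) : Measurable (next w) :=
  measurable_pi_lambda _ fun l =>
    (measurable_eval_of_countable ((measurable_blockLen w).add_const l)).sub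
      (measurable_eval_of_countable (measurable_blockLen w))

theorem measurable_block {d : ℕ} (w : EuclideanSpace ℝ (Fin d)) : Measurable (block w) :=
  (measurable_blockLen w).prodMk (measurable_eval_of_countable (measurable_blockLen w))

theorem averagedLaw_blockLen_inter {d : ℕ} (μ : Measure (JumpLaw d)) [IsProbabilityMeasure μ]
    (w : EuclideanSpace ℝ (Fin d)) (hw : TransientIn μ w)
    (hfin : ∀ᵐ X ∂averagedLaw μ, regenTime w X ≠ ⊤) (n : ℕ) {E : Set (Path d)}
    (hE : DependsUpTo n E) {B : Set (Path d)} (hB : MeasurableSet B) :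
    averagedLaw μ (blockLen w ⁻¹' {n} ∩ E ∩ next w ⁻¹' B) =
      averagedLaw μ (blockLen w ⁻¹' {n} ∩ E) * noBacktrackLaw μ w B := by
  by_cases hn : n = 0
  · have h0 : averagedLaw μ (blockLen w ⁻¹' {n}) = 0 := by
      rw [ae_iff] at hfin
      refine measure_mono_null (fun X hX => ?_) hfin
      simp only [hn, Set.mem_preimage, Set.mem_singleton_iff] at hX
      simpa [regenTime_eq_top_iff_blockLen] using hX
    rw [measure_mono_null _ h0, measure_mono_null _ h0, zero_mul]
    · exact Set.inter_subset_left
    · exact Set.inter_subset_left.trans Set.inter_subset_left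
  · have e : blockLen w ⁻¹' {n} = {X | regenTime w X = n} := by
      ext X
      exact (regenTime_eq_iff_blockLen w X hn).symm
    rw [e, ← averagedLaw_regenTime_inter μ w hw hE hB, ← e]
    congr 1
    ext X
    simp only [Set.mem_inter_iff, Set.mem_preimage, Set.mem_singleton_iff, next]
    constructor
    · rintro ⟨⟨h1, h2⟩, h3⟩
      exact ⟨⟨h1, h2⟩, h1 ▸ h3⟩
    · rintro ⟨⟨h1, h2⟩, h3⟩
      exact ⟨⟨h1, h2⟩, h1.symm ▸ h3⟩

/-- The value of the first regeneration time only affects the past factor, so summing over it leaves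
the law of the future unchanged. -/
theorem map_next_averagedLaw {d : ℕ} (μ : Measure (JumpLaw d)) [IsProbabilityMeasure μ]
    (w : EuclideanSpace ℝ (Fin d)) (hw : TransientIn μ w)
    (hfin : ∀ᵐ X ∂averagedLaw μ, regenTime w X ≠ ⊤) :
    (averagedLaw μ).map (next w) = noBacktrackLaw μ w := by
  have hU : (⋃ n, blockLen w ⁻¹' {n}) = (Set.univ : Set (Path d)) := by
    ext X; simp
  have hdis : Pairwise (Function.onFun Disjoint fun n => blockLen w ⁻¹' {n}) := by
    intro a b hab
    exact Disjoint.preimage _ (Set.disjoint_singleton.2 hab)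
  have hm : ∀ n, MeasurableSet (blockLen w ⁻¹' {n}) := fun n =>
    measurable_blockLen w (measurableSet_singleton n)
  ext B hB
  have hsum : averagedLaw μ (next w ⁻¹' B) =
      ∑' n, averagedLaw μ (blockLen w ⁻¹' {n} ∩ next w ⁻¹' B) := by
    rw [← measure_iUnion (fun a b hab => (hdis hab).mono Set.inter_subset_left
      Set.inter_subset_left) fun n => (hm n).inter (measurable_next w hB),
      ← Set.iUnion_inter, hU, Set.univ_inter]
  rw [Measure.map_apply (measurable_next w) hB, hsum]
  have key := fun n => averagedLaw_blockLen_inter μ w hw hfin n (E := Set.univ)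
    (fun _ _ _ _ => trivial) hB
  simp only [Set.inter_univ] at key
  simp_rw [key]
  rw [ENNReal.tsum_mul_right, ← measure_iUnion hdis hm, hU, measure_univ, one_mul]

/-- Under the law of the walk that never backtracks, the first regeneration block is independent
of the rest of the path, which has the same law again. -/
theorem noBacktrackLaw_block_inter {d : ℕ} (μ : Measure (JumpLaw d)) [IsProbabilityMeasure μ]
    (w : EuclideanSpace ℝ (Fin d)) (hw : TransientIn μ w)
    (hfin : ∀ᵐ X ∂averagedLaw μ, regenTime w X ≠ ⊤) (a : ℕ × Site d) {B : Set (Path d)}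
    (hB : MeasurableSet B) :
    noBacktrackLaw μ w (block w ⁻¹' {a} ∩ next w ⁻¹' B) =
      noBacktrackLaw μ w (block w ⁻¹' {a}) * noBacktrackLaw μ w B := by
  obtain ⟨n, x⟩ := a
  have hE : DependsUpTo n (noBackUpTo w n ∩ {X : Path d | X n = x}) := by
    refine (dependsUpTo_noBackUpTo w n).inter fun X hX Y hY => ?_
    simp only [Set.mem_ofPred_eq] at hX ⊢
    rwa [hY n le_rfl]
  have h0 : averagedLaw μ (blockLen w ⁻¹' {0}) = 0 := by
    rw [ae_iff] at hfin
    refine measure_mono_null (fun X hX => ?_) hfin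
    simpa [regenTime_eq_top_iff_blockLen] using hX
  have e : ∀ S : Set (Path d), averagedLaw μ (noBack w ∩ (block w ⁻¹' {(n, x)} ∩ S)) =
      averagedLaw μ (blockLen w ⁻¹' {n} ∩ (noBackUpTo w n ∩ {X : Path d | X n = x}) ∩ S) := by
    intro S
    by_cases hn : n = 0
    · rw [measure_mono_null _ h0, measure_mono_null _ h0]
      · rintro X ⟨⟨h1, _⟩, _⟩
        rwa [hn] at h1
      · rintro X ⟨_, h1, _⟩
        simp only [block, hn, Set.mem_preimage, Set.mem_singleton_iff, Prod.mk.injEq] at h1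
        exact h1.1
    · congr 1
      ext X
      simp only [block, Set.mem_inter_iff, Set.mem_preimage, Set.mem_singleton_iff,
        Prod.mk.injEq, Set.mem_ofPred_eq]
      constructor
      · rintro ⟨h1, ⟨h2, h3⟩, h4⟩
        exact ⟨⟨h2, fun j _ => h1 j, h2 ▸ h3⟩, h4⟩
      · rintro ⟨⟨h1, h2, h3⟩, h4⟩
        refine ⟨fun j => ?_, ⟨h1, h1.symm ▸ h3⟩, h4⟩
        rcases le_total j n with hj | hj
        · exact h2 j hj
        -- On a block of length `n`, the whole event `noBack w` reduces to `noBackUpTo w n`: after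
        -- time `n` the path stays above `X n`, which is above `X 0`. Conditioning thus concerns
        -- only the past of `n`.
        · have hr := ((regenTime_eq_coe_iff w X n).1
            ((regenTime_eq_iff_blockLen w X hn).2 h1)).1
          exact (h2 n le_rfl).trans (hr.2.2 j hj)
  have e' := e Set.univ
  simp only [Set.inter_univ] at e'
  rw [noBacktrackLaw_apply, e, averagedLaw_blockLen_inter μ w hw hfin n hE hB,
    noBacktrackLaw_apply μ w (block w ⁻¹' _), e', mul_assoc]

/-! ### Abstract renewal structure and a Chernoff bound. -/

section Renewal

variable {Ω α : Type*} [MeasurableSpace Ω] [MeasurableSpace α] [Countable α]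
  [MeasurableSingletonClass α] {ν : Measure Ω} {f : Ω → α} {Φ : Ω → Ω}

theorem lintegral_mul_of_independent_next (hf : Measurable f) (hΦ : Measurable Φ)
    (h : ∀ a B, MeasurableSet B → ν (f ⁻¹' {a} ∩ Φ ⁻¹' B) = ν (f ⁻¹' {a}) * ν B)
    (φ : α → ℝ≥0∞) {ψ : Ω → ℝ≥0∞} (hψ : Measurable ψ) :
    ∫⁻ x, φ (f x) * ψ (Φ x) ∂ν = (∫⁻ x, φ (f x) ∂ν) * ∫⁻ x, ψ x ∂ν := by
  have hU : (⋃ a, f ⁻¹' {a}) = (Set.univ : Set Ω) := by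
    ext X; simp
  have hdis : Pairwise (Function.onFun Disjoint fun a => f ⁻¹' {a}) := fun a b hab =>
    Disjoint.preimage _ (Set.disjoint_singleton.2 hab)
  have hm : ∀ a, MeasurableSet (f ⁻¹' {a}) := fun a => hf (measurableSet_singleton a)
  have hsum : ∀ F : Ω → ℝ≥0∞, ∫⁻ x, F x ∂ν = ∑' a, ∫⁻ x in f ⁻¹' {a}, F x ∂ν := by
    intro F
    rw [← lintegral_iUnion hm hdis, hU, Measure.restrict_univ]
  have hmap : ∀ a, (ν.restrict (f ⁻¹' {a})).map Φ = ν (f ⁻¹' {a}) • ν := by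
    intro a
    ext B hB
    rw [Measure.map_apply hΦ hB, Measure.restrict_apply (hΦ hB), Set.inter_comm, h a B hB]
    rfl
  rw [hsum, hsum fun x => φ (f x), ← ENNReal.tsum_mul_right]
  refine tsum_congr fun a => ?_
  have e1 : ∫⁻ x in f ⁻¹' {a}, φ (f x) * ψ (Φ x) ∂ν =
      ∫⁻ x in f ⁻¹' {a}, φ a * ψ (Φ x) ∂ν :=
    setLIntegral_congr_fun (hm a) fun x hx => by
      rw [Set.mem_preimage, Set.mem_singleton_iff] at hx
      simp only [hx]
  have e2 : ∫⁻ x in f ⁻¹' {a}, φ (f x) ∂ν = φ a * ν (f ⁻¹' {a}) := by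
    rw [← setLIntegral_const]
    exact setLIntegral_congr_fun (hm a) fun x hx => by
      rw [Set.mem_preimage, Set.mem_singleton_iff] at hx
      simp only [hx]
  rw [e1, e2, lintegral_const_mul (f := fun x => ψ (Φ x)) _ (hψ.comp hΦ), ← lintegral_map hψ hΦ, hmap,
    lintegral_smul_measure, smul_eq_mul, mul_assoc]

theorem measurePreserving_of_independent_next [IsProbabilityMeasure ν] (hf : Measurable f)
    (hΦ : Measurable Φ)
    (h : ∀ a B, MeasurableSet B → ν (f ⁻¹' {a} ∩ Φ ⁻¹' B) = ν (f ⁻¹' {a}) * ν B) :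
    MeasurePreserving Φ ν ν := by
  refine ⟨hΦ, ?_⟩
  ext B hB
  have := lintegral_mul_of_independent_next hf hΦ h (fun _ => 1)
    (ψ := B.indicator 1) (measurable_one.indicator hB)
  simp only [one_mul, lintegral_const, measure_univ, lintegral_indicator_one hB] at this
  rw [Measure.map_apply hΦ hB, ← this, ← lintegral_indicator_one (hΦ hB)]
  rfl

/-- Read along the iterates of `Φ`, the values of `f` are i.i.d.; the induction splits off the first
factor. -/
theorem lintegral_prod_iterate_of_independent_next [IsProbabilityMeasure ν] (hf : Measurable f)
    (hΦ : Measurable Φ)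
    (h : ∀ a B, MeasurableSet B → ν (f ⁻¹' {a} ∩ Φ ⁻¹' B) = ν (f ⁻¹' {a}) * ν B)
    (φ : α → ℝ≥0∞) (k : ℕ) :
    ∫⁻ x, ∏ i ∈ Finset.range k, φ (f (Φ^[i] x)) ∂ν = (∫⁻ x, φ (f x) ∂ν) ^ k := by
  induction k with
  | zero => simp
  | succ k ih =>
    have hmeas : Measurable fun x => ∏ i ∈ Finset.range k, φ (f (Φ^[i] x)) :=
      Finset.measurable_prod _ fun i _ =>
        (measurable_of_countable φ).comp (hf.comp (hΦ.iterate i))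
    have := lintegral_mul_of_independent_next hf hΦ h φ hmeas
    rw [ih, ← pow_succ'] at this
    rw [← this]
    refine lintegral_congr fun x => ?_
    rw [Finset.prod_range_succ', mul_comm]
    rfl

/-- Chernoff's bound for truncated summands: the expected product is the `k`-th power of a number at
most `1`, so the estimate is uniform in `k`. -/
theorem measure_sum_le_of_independent_next [IsProbabilityMeasure ν] (hf : Measurable f)
    (hΦ : Measurable Φ)
    (h : ∀ a B, MeasurableSet B → ν (f ⁻¹' {a} ∩ Φ ⁻¹' B) = ν (f ⁻¹' {a}) * ν B)
    (S : Set α) [DecidablePred (· ∈ S)] (Z : α → ℝ) (l D : ℝ) (hl : 0 ≤ l)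
    (h1 : ∫⁻ x, (if f x ∈ S then ENNReal.ofReal (Real.exp (-(l * Z (f x)))) else 0) ∂ν ≤ 1)
    (k : ℕ) :
    ν {x | (∀ i < k, f (Φ^[i] x) ∈ S) ∧ ∑ i ∈ Finset.range k, Z (f (Φ^[i] x)) ≤ -D} ≤
      ENNReal.ofReal (Real.exp (-(l * D))) := by
  set φ : α → ℝ≥0∞ := fun a => if a ∈ S then ENNReal.ofReal (Real.exp (-(l * Z a))) else 0
  have hprod := lintegral_prod_iterate_of_independent_next hf hΦ h φ k
  have hle : ∫⁻ x, ∏ i ∈ Finset.range k, φ (f (Φ^[i] x)) ∂ν ≤ 1 := by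
    rw [hprod]
    exact pow_le_one' h1 k
  have hmeas : Measurable fun x => ∏ i ∈ Finset.range k, φ (f (Φ^[i] x)) :=
    Finset.measurable_prod _ fun i _ =>
      (measurable_of_countable φ).comp (hf.comp (hΦ.iterate i))
  have hmk := mul_meas_ge_le_lintegral (μ := ν) hmeas (ENNReal.ofReal (Real.exp (l * D)))
  have hsub : {x | (∀ i < k, f (Φ^[i] x) ∈ S) ∧
      ∑ i ∈ Finset.range k, Z (f (Φ^[i] x)) ≤ -D} ⊆
      {x | ENNReal.ofReal (Real.exp (l * D)) ≤ ∏ i ∈ Finset.range k, φ (f (Φ^[i] x))} := by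
    rintro x ⟨hx1, hx2⟩
    have : ∏ i ∈ Finset.range k, φ (f (Φ^[i] x)) =
        ENNReal.ofReal (Real.exp (-(l * ∑ i ∈ Finset.range k, Z (f (Φ^[i] x))))) := by
      rw [Finset.mul_sum, ← Finset.sum_neg_distrib, Real.exp_sum,
        ENNReal.ofReal_prod_of_nonneg fun i _ => (Real.exp_pos _).le]
      refine Finset.prod_congr rfl fun i hi => ?_
      exact if_pos (hx1 i (Finset.mem_range.1 hi))
    rw [Set.mem_ofPred_eq, this]
    gcongr
    nlinarith
  have hpos : 0 < Real.exp (l * D) := Real.exp_pos _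
  calc _ ≤ ν {x | ENNReal.ofReal (Real.exp (l * D)) ≤ ∏ i ∈ Finset.range k, φ (f (Φ^[i] x))} :=
        measure_mono hsub
    _ ≤ 1 / ENNReal.ofReal (Real.exp (l * D)) := by
        rw [ENNReal.le_div_iff_mul_le (Or.inl (by simpa using hpos)) (Or.inl ENNReal.ofReal_ne_top),
          mul_comm]
        exact hmk.trans hle
    _ = _ := by
        rw [Real.exp_neg, ENNReal.ofReal_inv_of_pos hpos, one_div]

end Renewal

/-! ### Truncated exponential moments. -/

theorem exp_neg_le_quadratic {x : ℝ} (hx : |x| ≤ 1) : Real.exp (-x) ≤ 1 - x + x ^ 2 := by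
  have := Real.abs_exp_sub_one_sub_id_le (x := -x) (by rwa [abs_neg])
  have := (abs_le.1 this).2
  nlinarith

/-- With `l = 1 / (C * B)` one has `|l * Z| ≤ 1` on `T ≤ B`, so the quadratic bound on the
exponential applies there. The truncated mean tends to the positive mean of `Z`, while `l * E[Z ^
2]` tends to `0`; for large `B` the linear gain beats the quadratic error. -/
theorem exists_lintegral_exp_truncated_le_one {Ω : Type*} [MeasurableSpace Ω] (ν : Measure Ω)
    [IsProbabilityMeasure ν] {Z T : Ω → ℝ} (hT : Measurable T) {C : ℝ}
    (hC : 0 < C) (hZT : ∀ᵐ x ∂ν, |Z x| ≤ C * T x) (hZ : Integrable Z ν)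
    (hZ2 : Integrable (fun x => Z x ^ 2) ν) (hpos : 0 < ∫ x, Z x ∂ν) :
    ∀ᶠ B : ℝ in atTop, ∫⁻ x, (if T x ≤ B then
      ENNReal.ofReal (Real.exp (-(1 / (C * B) * Z x))) else 0) ∂ν ≤ 1 := by
  have hS : ∀ B, MeasurableSet {x | T x ≤ B} := fun B => measurableSet_le hT measurable_const
  have hlim1 : Tendsto (fun B : ℝ => ∫ x in {x | T x ≤ B}, Z x ∂ν) atTop
      (𝓝 (∫ x, Z x ∂ν)) := by
    simp_rw [← integral_indicator (hS _)]
    refine tendsto_integral_filter_of_dominated_convergence (fun x => |Z x|)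
      (Eventually.of_forall fun B => hZ.aestronglyMeasurable.indicator (hS B))
      (Eventually.of_forall fun B => Eventually.of_forall fun x => ?_) hZ.abs
      (Eventually.of_forall fun x => ?_)
    · rw [← Real.norm_eq_abs]
      exact norm_indicator_le_norm_self _ _
    · refine tendsto_const_nhds.congr' ?_
      filter_upwards [eventually_ge_atTop (T x)] with B hB
      rw [Set.indicator_of_mem (by exact hB)]
  have hlim2 : Tendsto (fun B : ℝ => 1 / (C * B) * ∫ x, Z x ^ 2 ∂ν) atTop (𝓝 0) := by
    have : Tendsto (fun B : ℝ => 1 / (C * B)) atTop (𝓝 0) :=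
      tendsto_const_nhds.div_atTop (tendsto_id.const_mul_atTop hC)
    simpa using this.mul_const (∫ x, Z x ^ 2 ∂ν)
  -- Half of the mean of `Z` is the threshold between the two limits: the truncated mean ends above
  -- it and `l * E[Z ^ 2]` below it.
  filter_upwards [hlim1.eventually (lt_mem_nhds (half_lt_self hpos)),
    hlim2.eventually (gt_mem_nhds (half_pos hpos)), eventually_gt_atTop 0] with B h1 h2 hB
  set l : ℝ := 1 / (C * B) with hl
  have hl0 : 0 < l := by positivity
  have hint : Integrable (fun x => 1 - l * Z x + l ^ 2 * Z x ^ 2) ν :=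
    ((integrable_const 1).sub (hZ.const_mul l)).add (hZ2.const_mul (l ^ 2))
  have hnn : ∀ x, 0 ≤ 1 - l * Z x + l ^ 2 * Z x ^ 2 := fun x => by
    nlinarith [sq_nonneg (l * Z x - 1), sq_nonneg (l * Z x)]
  calc ∫⁻ x, (if T x ≤ B then ENNReal.ofReal (Real.exp (-(l * Z x))) else 0) ∂ν
      ≤ ∫⁻ x, {x | T x ≤ B}.indicator
          (fun x => ENNReal.ofReal (1 - l * Z x + l ^ 2 * Z x ^ 2)) x ∂ν := by
        refine lintegral_mono_ae ?_
        filter_upwards [hZT] with x hx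
        by_cases hxB : T x ≤ B
        · rw [if_pos hxB, Set.indicator_of_mem (by exact hxB), ← mul_pow]
          refine ENNReal.ofReal_le_ofReal (exp_neg_le_quadratic ?_)
          rw [abs_mul, abs_of_pos hl0, hl, one_div, inv_mul_le_iff₀ (by positivity), mul_one]
          exact hx.trans (mul_le_mul_of_nonneg_left hxB hC.le)
        · rw [if_neg hxB]
          exact zero_le
    _ = ENNReal.ofReal (∫ x in {x | T x ≤ B}, (1 - l * Z x + l ^ 2 * Z x ^ 2) ∂ν) := by
        rw [lintegral_indicator (hS B),
          ofReal_integral_eq_lintegral_ofReal hint.integrableOn (Eventually.of_forall hnn)]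
    _ ≤ 1 := by
        rw [← ENNReal.ofReal_one]
        refine ENNReal.ofReal_le_ofReal ?_
        have e1 : ∫ x in {x | T x ≤ B}, (1 - l * Z x + l ^ 2 * Z x ^ 2) ∂ν =
            (∫ x in {x | T x ≤ B}, (1 : ℝ) ∂ν) - l * (∫ x in {x | T x ≤ B}, Z x ∂ν) +
              l ^ 2 * ∫ x in {x | T x ≤ B}, Z x ^ 2 ∂ν := by
          rw [integral_add, integral_sub, integral_const_mul, integral_const_mul]
          · exact (integrable_const 1).integrableOn
          · exact (hZ.const_mul l).integrableOn
          · exact ((integrable_const 1).sub (hZ.const_mul l)).integrableOn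
          · exact (hZ2.const_mul (l ^ 2)).integrableOn
        have e2 : ∫ x in {x | T x ≤ B}, (1 : ℝ) ∂ν ≤ 1 := by
          simp [measureReal_le_one]
        have e3 : ∫ x in {x | T x ≤ B}, Z x ^ 2 ∂ν ≤ ∫ x, Z x ^ 2 ∂ν :=
          setIntegral_le_integral hZ2 (Eventually.of_forall fun x => sq_nonneg _)
        rw [e1]
        have e4 : l * (l * ∫ x in {x | T x ≤ B}, Z x ^ 2 ∂ν) ≤
            l * (∫ x in {x | T x ≤ B}, Z x ∂ν) := by
          refine mul_le_mul_of_nonneg_left ?_ hl0.le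
          have := mul_le_mul_of_nonneg_left e3 hl0.le
          linarith
        nlinarith

/-! ### Bounded steps, moments of a block and its drift. -/

theorem toVec_sub {d : ℕ} (x y : Site d) : toVec (x - y) = toVec x - toVec y := by
  ext i; simp [toVec]

/-- All steps of the path have length at most `M`. -/
def StepsLE {d : ℕ} (M : ℝ) (X : Path d) : Prop := ∀ n, ‖toVec (X (n + 1) - X n)‖ ≤ M

theorem StepsLE.shift {d : ℕ} {M : ℝ} {X : Path d} (h : StepsLE M X) (n : ℕ) :
    StepsLE M (shift n X) := fun l => by
  have := h (n + l)
  simpa only [RWRE.shift, sub_sub_sub_cancel_right, add_assoc] using this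

theorem StepsLE.norm_sub_le {d : ℕ} {M : ℝ} {X : Path d} (h : StepsLE M X) (n l : ℕ) :
    ‖toVec (X (n + l) - X n)‖ ≤ M * l := by
  induction l with
  | zero => rw [add_zero, toVec_sub, sub_self]; simp
  | succ l ih =>
    have e : toVec (X (n + (l + 1)) - X n) =
        toVec (X (n + l + 1) - X (n + l)) + toVec (X (n + l) - X n) := by
      simp only [toVec_sub]; abel_nf
    rw [e]
    refine (norm_add_le _ _).trans ?_
    push_cast
    linarith [h (n + l)]

theorem StepsLE.abs_height_sub_le {d : ℕ} {M : ℝ} {X : Path d} (h : StepsLE M X)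
    (u : EuclideanSpace ℝ (Fin d)) (n l : ℕ) :
    |height u (X (n + l)) - height u (X n)| ≤ ‖u‖ * M * l := by
  rw [← height_sub, height, mul_assoc, mul_comm ‖u‖]
  exact (abs_real_inner_le_norm _ _).trans
    (mul_le_mul_of_nonneg_right (h.norm_sub_le n l) (norm_nonneg u))

theorem coe_regenTime {d : ℕ} (w : EuclideanSpace ℝ (Fin d)) (X : Path d) :
    (regenTime w X : ℝ≥0∞) = if blockLen w X = 0 then ⊤ else (blockLen w X : ℝ≥0∞) := by
  split_ifs with h
  · rw [(regenTime_eq_top_iff_blockLen w X).2 h]; rfl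
  · rw [(regenTime_eq_iff_blockLen w X h).2 rfl]; rfl

theorem measurable_natCast_blockLen {d : ℕ} (w : EuclideanSpace ℝ (Fin d)) :
    Measurable fun X : Path d => (blockLen w X : ℝ) :=
  (measurable_of_countable fun n : ℕ => (n : ℝ)).comp (measurable_blockLen w)

theorem measurable_coe_regenTime {d : ℕ} (w : EuclideanSpace ℝ (Fin d)) :
    Measurable fun X : Path d => (regenTime w X : ℝ≥0∞) := by
  simp_rw [coe_regenTime]
  exact (measurable_of_countable fun n : ℕ => if n = 0 then (⊤ : ℝ≥0∞) else n).comp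
    (measurable_blockLen w)

section

variable {d : ℕ} (μ : Measure (JumpLaw d)) (w : EuclideanSpace ℝ (Fin d)) {p : ℝ}

theorem ae_regenTime_ne_top (hp : 0 < p) (hmom : regenMoment μ w p < ⊤) :
    ∀ᵐ X ∂averagedLaw μ, regenTime w X ≠ ⊤ := by
  filter_upwards [ae_lt_top ((measurable_coe_regenTime w).pow_const p) hmom.ne] with X hX h
  rw [h] at hX
  simp [ENNReal.top_rpow_of_pos hp] at hX

theorem lintegral_blockLen_rpow_le (hp : 0 < p) :
    ∫⁻ X, (blockLen w X : ℝ≥0∞) ^ p ∂averagedLaw μ ≤ regenMoment μ w p := by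
  refine lintegral_mono fun X => ?_
  refine ENNReal.rpow_le_rpow ?_ hp.le
  rw [coe_regenTime]
  split_ifs with h
  · exact le_top
  · exact le_rfl

variable [IsProbabilityMeasure μ]

theorem lintegral_blockLen_rpow_noBacktrackLaw_lt_top (hw : TransientIn μ w) (hp : 0 < p)
    (hmom : regenMoment μ w p < ⊤) :
    ∫⁻ X, (blockLen w X : ℝ≥0∞) ^ p ∂noBacktrackLaw μ w < ⊤ := by
  refine (lintegral_mono' (noBacktrackLaw_le μ w) le_rfl).trans_lt ?_
  rw [lintegral_smul_measure]
  exact ENNReal.mul_lt_top (ENNReal.inv_lt_top.2 (averagedLaw_noBack_pos μ w hw))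
    ((lintegral_blockLen_rpow_le μ w hp).trans_lt hmom)

theorem integrable_blockLen_sq (hw : TransientIn μ w) (hp : 2 ≤ p)
    (hmom : regenMoment μ w p < ⊤) :
    Integrable (fun X => (blockLen w X : ℝ) ^ 2) (noBacktrackLaw μ w) := by
  have hm : Measurable fun X : Path d => (blockLen w X : ℝ) ^ 2 :=
    (measurable_of_countable fun n : ℕ => (n : ℝ) ^ 2).comp (measurable_blockLen w)
  refine ⟨hm.aestronglyMeasurable, ?_⟩
  rw [hasFiniteIntegral_iff_ofReal (Eventually.of_forall fun X => by positivity)]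
  refine lt_of_le_of_lt (lintegral_mono fun X => ?_)
    (lintegral_blockLen_rpow_noBacktrackLaw_lt_top μ w hw (by linarith) hmom)
  rw [ENNReal.ofReal_pow (Nat.cast_nonneg _), ENNReal.ofReal_natCast]
  rcases Nat.eq_zero_or_pos (blockLen w X) with h | h
  · simp [h]
  · rw [← ENNReal.rpow_natCast]
    exact ENNReal.rpow_le_rpow_of_exponent_le (by exact_mod_cast h) (by exact_mod_cast hp)

theorem integrable_blockLen (hw : TransientIn μ w) (hp : 2 ≤ p)
    (hmom : regenMoment μ w p < ⊤) :
    Integrable (fun X => (blockLen w X : ℝ)) (noBacktrackLaw μ w) := by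
  have hm := measurable_natCast_blockLen w
  refine (integrable_blockLen_sq μ w hw hp hmom).mono' hm.aestronglyMeasurable
    (Eventually.of_forall fun X => ?_)
  rw [Real.norm_eq_abs, abs_of_nonneg (Nat.cast_nonneg _)]
  exact_mod_cast Nat.le_self_pow two_ne_zero _

/-- The advance in direction `u` over a block, minus `2c` times its length. -/
noncomputable def drift (u : EuclideanSpace ℝ (Fin d)) (c : ℝ) (a : ℕ × Site d) : ℝ :=
  height u a.2 - 2 * c * a.1

/-- Up to the positive factor `E[σ]⁻¹`, `u · v` is the mean advance of a block in direction `u`. -/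
theorem exists_drift_pos (hs : BoundedSteps μ) (hw : TransientIn μ w) (hp : 2 ≤ p)
    (hmom : regenMoment μ w p < ⊤) (u : EuclideanSpace ℝ (Fin d))
    (huv : 0 < inner ℝ u (velocity μ w)) :
    ∃ c > 0, Integrable (fun X => drift u c (block w X)) (noBacktrackLaw μ w) ∧
      0 < ∫ X, drift u c (block w X) ∂noBacktrackLaw μ w := by
  obtain ⟨M, hM, hX⟩ := ae_bounded_steps μ hs
  have hT := integrable_blockLen μ w hw hp hmom
  have hV : Integrable (fun X => toVec (X (blockLen w X))) (noBacktrackLaw μ w) := by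
    have hm : Measurable fun X : Path d => toVec (X (blockLen w X)) :=
      (measurable_of_countable (toVec (d := d))).comp
        (measurable_eval_of_countable (measurable_blockLen w))
    refine (hT.const_mul M).mono' hm.aestronglyMeasurable ?_
    refine (noBacktrackLaw_absolutelyContinuous μ w).ae_le ?_
    filter_upwards [hX, ae_eq_zero_start μ] with X h1 h2
    have := StepsLE.norm_sub_le h1 0 (blockLen w X)
    rwa [h2, sub_zero, zero_add] at this
  have hh : Integrable (fun X => height u (X (blockLen w X))) (noBacktrackLaw μ w) :=
    hV.inner_const u
  have hv : inner ℝ u (velocity μ w) = (∫ X, (blockLen w X : ℝ) ∂noBacktrackLaw μ w)⁻¹ *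
      ∫ X, height u (X (blockLen w X)) ∂noBacktrackLaw μ w := by
    rw [velocity, inner_smul_right]
    congr 1
    refine (integral_inner hV u).symm.trans ?_
    refine integral_congr_ae (Eventually.of_forall fun X => ?_)
    exact real_inner_comm _ _
  rw [hv] at huv
  set t := ∫ X, (blockLen w X : ℝ) ∂noBacktrackLaw μ w
  set b := ∫ X, height u (X (blockLen w X)) ∂noBacktrackLaw μ w
  have ht0 : 0 ≤ t := integral_nonneg fun X => Nat.cast_nonneg _
  have ht : 0 < t := by
    rcases ht0.eq_or_lt with h | h
    · rw [← h] at huv; simp at huv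
    · exact h
  have hb : 0 < b := (pos_iff_pos_of_mul_pos huv).1 (inv_pos.2 ht)
  -- This `c` spends half of the mean advance `b`, so the mean drift is `b / 2`.
  refine ⟨b / (4 * t), by positivity, hh.sub (hT.const_mul _), ?_⟩
  have e : ∀ c, ∫ X, drift u c (block w X) ∂noBacktrackLaw μ w = b - 2 * c * t := by
    intro c
    refine (integral_sub hh (hT.const_mul (2 * c))).trans ?_
    rw [integral_const_mul]
  rw [e]
  have : 2 * (b / (4 * t)) * t = b / 2 := by field_simp; ring
  linarith

theorem exists_measure_sum_drift_le (hs : BoundedSteps μ) (hw : TransientIn μ w) (hp : 2 ≤ p)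
    (hmom : regenMoment μ w p < ⊤) (u : EuclideanSpace ℝ (Fin d)) {c : ℝ} (hc : 0 < c)
    (hint : Integrable (fun X => drift u c (block w X)) (noBacktrackLaw μ w))
    (hpos : 0 < ∫ X, drift u c (block w X) ∂noBacktrackLaw μ w) :
    ∃ C > 0, ∀ᶠ B : ℝ in atTop, ∀ (k : ℕ) (D : ℝ), noBacktrackLaw μ w
      {X | (∀ i < k, (blockLen w ((next w)^[i] X) : ℝ) ≤ B) ∧
        ∑ i ∈ Finset.range k, drift u c (block w ((next w)^[i] X)) ≤ -D} ≤
      ENNReal.ofReal (Real.exp (-(1 / (C * B) * D))) := by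
  classical
  obtain ⟨M, hM, hX⟩ := ae_bounded_steps μ hs
  have hprob := isProbabilityMeasure_noBacktrackLaw μ w hw
  have hT2 := integrable_blockLen_sq μ w hw hp hmom
  -- Steps of size at most `M` bound the drift of a block by `C` times its length, so truncating
  -- lengths truncates drifts.
  set C : ℝ := ‖u‖ * M + 2 * c with hC
  have hC0 : 0 < C := by positivity
  have hZT : ∀ᵐ X ∂noBacktrackLaw μ w, |drift u c (block w X)| ≤ C * blockLen w X := by
    refine (noBacktrackLaw_absolutelyContinuous μ w).ae_le ?_
    filter_upwards [hX, ae_eq_zero_start μ] with X h1 h2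
    have := StepsLE.abs_height_sub_le h1 u 0 (blockLen w X)
    rw [h2, height_zero, sub_zero, zero_add] at this
    refine (abs_sub _ _).trans ?_
    rw [abs_of_nonneg (a := 2 * c * _) (by positivity), hC, add_mul]
    exact add_le_add_left this _
  have hZ2 : Integrable (fun X => drift u c (block w X) ^ 2) (noBacktrackLaw μ w) := by
    refine (hT2.const_mul (C ^ 2)).mono' (hint.aestronglyMeasurable.pow 2) ?_
    filter_upwards [hZT] with X h
    rw [Real.norm_eq_abs, abs_of_nonneg (sq_nonneg _), ← sq_abs, ← mul_pow]
    exact pow_le_pow_left₀ (abs_nonneg _) h 2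
  refine ⟨C, hC0, ?_⟩
  filter_upwards [exists_lintegral_exp_truncated_le_one (noBacktrackLaw μ w)
    (measurable_natCast_blockLen w) hC0
    hZT hint hZ2 hpos, eventually_ge_atTop 0] with B hB hB0 k D
  exact measure_sum_le_of_independent_next (measurable_block w) (measurable_next w)
    (fun a B hB => noBacktrackLaw_block_inter μ w hw
      (ae_regenTime_ne_top μ w (by linarith) hmom) a hB)
    {a : ℕ × Site d | (a.1 : ℝ) ≤ B} (drift u c) (1 / (C * B)) D (by positivity) hB k

end

/-! ### Exceptional paths at scale `N`. -/

/-- The first `k` blocks are not longer than `N²`, yet the total drift over them is at most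
`-N³`. -/
def lowSum {d : ℕ} (w u : EuclideanSpace ℝ (Fin d)) (c : ℝ) (N k : ℕ) : Set (Path d) :=
  {X | (∀ i < k, (blockLen w ((next w)^[i] X) : ℝ) ≤ (N : ℝ) ^ 2) ∧
    ∑ i ∈ Finset.range k, drift u c (block w ((next w)^[i] X)) ≤ -(N : ℝ) ^ 3}

/-- Exceptional paths at scale `N`: among the first `2N⁴` blocks there is one longer than `N²`,
or a run of blocks with a drift at most `-N³`. -/
def bad {d : ℕ} (w u : EuclideanSpace ℝ (Fin d)) (c : ℝ) (N : ℕ) : Set (Path d) :=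
  (⋃ k ∈ Finset.range (2 * N ^ 4 + 1), (next w)^[k] ⁻¹' {X | (N : ℝ) ^ 2 < blockLen w X}) ∪
    ⋃ i ∈ Finset.range (2 * N ^ 4 + 1), ⋃ k ∈ Finset.range (2 * N ^ 4 + 1),
      (next w)^[i + 1] ⁻¹' lowSum w u c N k

theorem measurableSet_lowSum {d : ℕ} (w u : EuclideanSpace ℝ (Fin d)) (c : ℝ) (N k : ℕ) :
    MeasurableSet (lowSum w u c N k) := by
  have : lowSum w u c N k =
      (⋂ i : ℕ, ⋂ _ : i < k, {X | (blockLen w ((next w)^[i] X) : ℝ) ≤ (N : ℝ) ^ 2}) ∩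
      {X | ∑ i ∈ Finset.range k, drift u c (block w ((next w)^[i] X)) ≤ -(N : ℝ) ^ 3} := by
    ext X; simp [lowSum]
  rw [this]
  refine MeasurableSet.inter ?_ ?_
  · exact MeasurableSet.iInter fun i => MeasurableSet.iInter fun _ => measurableSet_le
      ((measurable_natCast_blockLen w).comp ((measurable_next w).iterate i)) measurable_const
  · exact measurableSet_le (Finset.measurable_sum _ fun i _ =>
      (measurable_of_countable (drift u c)).comp
        ((measurable_block w).comp ((measurable_next w).iterate i))) measurable_const

theorem measure_blockLen_gt_le {d : ℕ} (w : EuclideanSpace ℝ (Fin d)) (ν : Measure (Path d))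
    {p : ℝ} (hp : 0 < p) (hfin : ∫⁻ X, (blockLen w X : ℝ≥0∞) ^ p ∂ν < ⊤) {N : ℕ} (hN : 1 ≤ N) :
    ν {X | (N : ℝ) ^ 2 < blockLen w X} ≤
      ENNReal.ofReal ((∫⁻ X, (blockLen w X : ℝ≥0∞) ^ p ∂ν).toReal * (N : ℝ) ^ (-(2 * p))) := by
  have hN0 : (0 : ℝ) < N := by exact_mod_cast hN
  have hm : Measurable fun X : Path d => (blockLen w X : ℝ≥0∞) ^ p :=
    (measurable_of_countable fun n : ℕ => (n : ℝ≥0∞) ^ p).comp (measurable_blockLen w)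
  have key := mul_meas_ge_le_lintegral (μ := ν) hm (ENNReal.ofReal ((N : ℝ) ^ (2 * p)))
  have hsub : {X : Path d | (N : ℝ) ^ 2 < blockLen w X} ⊆
      {X | ENNReal.ofReal ((N : ℝ) ^ (2 * p)) ≤ (blockLen w X : ℝ≥0∞) ^ p} := by
    intro X hX
    have hX' : (N : ℝ) ^ 2 < blockLen w X := hX
    rw [Set.mem_ofPred_eq, Real.rpow_mul hN0.le, ← ENNReal.ofReal_rpow_of_nonneg (by positivity)
      hp.le, ← ENNReal.ofReal_natCast]
    gcongr
    exact_mod_cast hX'.le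
  have hpos : (0 : ℝ) < (N : ℝ) ^ (2 * p) := Real.rpow_pos_of_pos hN0 _
  rw [ENNReal.ofReal_mul ENNReal.toReal_nonneg, ENNReal.ofReal_toReal hfin.ne,
    Real.rpow_neg hN0.le, ENNReal.ofReal_inv_of_pos hpos, ← div_eq_mul_inv,
    ENNReal.le_div_iff_mul_le (Or.inl (by simpa using hpos)) (Or.inl ENNReal.ofReal_ne_top),
    mul_comm]
  exact (mul_le_mul_right (measure_mono hsub) _).trans key

section

variable {d : ℕ} (μ : Measure (JumpLaw d)) [IsProbabilityMeasure μ]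
  (w : EuclideanSpace ℝ (Fin d)) {p : ℝ}

/-- The first application of `next` turns the averaged law into the no-backtracking law, and later
ones preserve it. The first block has another law, which is why the runs in `bad` start at `i + 1`.
-/
theorem averagedLaw_iterate_next (hw : TransientIn μ w)
    (hfin : ∀ᵐ X ∂averagedLaw μ, regenTime w X ≠ ⊤) (i : ℕ) {B : Set (Path d)}
    (hB : MeasurableSet B) :
    averagedLaw μ ((next w)^[i + 1] ⁻¹' B) = noBacktrackLaw μ w B := by
  have hprob := isProbabilityMeasure_noBacktrackLaw μ w hw
  have hmp := (measurePreserving_of_independent_next (measurable_block w) (measurable_next w)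
    fun a B hB => noBacktrackLaw_block_inter μ w hw hfin a hB).iterate i
  rw [Function.iterate_succ, Set.preimage_comp,
    ← Measure.map_apply (measurable_next w) (hmp.measurable hB), map_next_averagedLaw μ w hw hfin,
    hmp.measure_preimage hB.nullMeasurableSet]

theorem exists_averagedLaw_bad_le (hs : BoundedSteps μ) (hw : TransientIn μ w) (hp : 2 ≤ p)
    (hmom : regenMoment μ w p < ⊤) (u : EuclideanSpace ℝ (Fin d)) {c : ℝ} (hc : 0 < c)
    (hint : Integrable (fun X => drift u c (block w X)) (noBacktrackLaw μ w))
    (hpos : 0 < ∫ X, drift u c (block w X) ∂noBacktrackLaw μ w) :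
    ∃ K ≥ 0, ∃ C > 0, ∀ᶠ N : ℕ in atTop, averagedLaw μ (bad w u c N) ≤
      ENNReal.ofReal ((2 * N ^ 4 + 1) * (K * (N : ℝ) ^ (-(2 * p))) +
        (2 * N ^ 4 + 1) ^ 2 * Real.exp (-(1 / C * N))) := by
  have hp0 : 0 < p := by linarith
  obtain ⟨C, hC, hev⟩ := exists_measure_sum_drift_le μ w hs hw hp hmom u hc hint hpos
  have hfin := ae_regenTime_ne_top μ w hp0 hmom
  have hf1 : ∫⁻ X, (blockLen w X : ℝ≥0∞) ^ p ∂averagedLaw μ < ⊤ :=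
    (lintegral_blockLen_rpow_le μ w hp0).trans_lt hmom
  have hf2 := lintegral_blockLen_rpow_noBacktrackLaw_lt_top μ w hw hp0 hmom
  set K₁ := (∫⁻ X, (blockLen w X : ℝ≥0∞) ^ p ∂averagedLaw μ).toReal with hK₁
  set K₂ := (∫⁻ X, (blockLen w X : ℝ≥0∞) ^ p ∂noBacktrackLaw μ w).toReal with hK₂
  have hK₁0 : 0 ≤ K₁ := ENNReal.toReal_nonneg
  have hK₂0 : 0 ≤ K₂ := ENNReal.toReal_nonneg
  refine ⟨K₁ + K₂, by positivity, C, hC, ?_⟩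
  have hsq : Tendsto (fun N : ℕ => (N : ℝ) ^ 2) atTop atTop :=
    (tendsto_pow_atTop two_ne_zero).comp tendsto_natCast_atTop_atTop
  filter_upwards [hsq.eventually hev, eventually_ge_atTop 1] with N hN hN1
  have hN0 : (0 : ℝ) < N := by exact_mod_cast hN1
  have hrp : (0 : ℝ) ≤ (N : ℝ) ^ (-(2 * p)) := Real.rpow_nonneg hN0.le _
  have h1 : ∀ k, averagedLaw μ ((next w)^[k] ⁻¹' {X | (N : ℝ) ^ 2 < blockLen w X}) ≤
      ENNReal.ofReal ((K₁ + K₂) * (N : ℝ) ^ (-(2 * p))) := by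
    rintro (_ | k)
    · refine (measure_blockLen_gt_le w (averagedLaw μ) hp0 hf1 hN1).trans ?_
      gcongr
      linarith
    · rw [averagedLaw_iterate_next μ w hw hfin k
        (measurableSet_lt measurable_const (measurable_natCast_blockLen w))]
      refine (measure_blockLen_gt_le w (noBacktrackLaw μ w) hp0 hf2 hN1).trans ?_
      gcongr
      linarith
  have h2 : ∀ i k, averagedLaw μ ((next w)^[i + 1] ⁻¹' lowSum w u c N k) ≤
      ENNReal.ofReal (Real.exp (-(1 / C * N))) := by
    intro i k
    rw [averagedLaw_iterate_next μ w hw hfin i (measurableSet_lowSum w u c N k)]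
    -- Truncation at `B = N ^ 2` and deviation `D = N ^ 3` leave the exponent `N / C`.
    refine (hN k ((N : ℝ) ^ 3)).trans_eq ?_
    congr 3
    field_simp
  have hcast : ((2 * N ^ 4 + 1 : ℕ) : ℝ) = 2 * (N : ℝ) ^ 4 + 1 := by push_cast; ring
  have hA : (0 : ℝ) ≤ 2 * (N : ℝ) ^ 4 + 1 := by positivity
  rw [ENNReal.ofReal_add (by positivity) (by positivity)]
  refine (measure_union_le _ _).trans (add_le_add ?_ ?_)
  · refine (measure_biUnion_finset_le _ _).trans ((Finset.sum_le_card_nsmul _ _ _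
      fun k _ => h1 k).trans_eq ?_)
    rw [Finset.card_range, nsmul_eq_mul, ENNReal.ofReal_mul hA, ← hcast, ENNReal.ofReal_natCast]
  · refine (measure_biUnion_finset_le _ _).trans ((Finset.sum_le_card_nsmul _ _ _
      fun i _ => (measure_biUnion_finset_le _ _).trans (Finset.sum_le_card_nsmul _ _ _
      fun k _ => h2 i k)).trans_eq ?_)
    rw [Finset.card_range, nsmul_eq_mul, nsmul_eq_mul, ENNReal.ofReal_mul (by positivity),
      ENNReal.ofReal_pow hA, ← hcast, ENNReal.ofReal_natCast, ← mul_assoc, sq]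

/-- Long blocks dominate: the probability is `O(N ^ (4 - 2p))`, and `q + 4 - 2p < -1` is the
condition on `q`. -/
theorem summable_averagedLaw_bad (hs : BoundedSteps μ) (hw : TransientIn μ w) (hp : 2 ≤ p)
    (hmom : regenMoment μ w p < ⊤) (u : EuclideanSpace ℝ (Fin d)) {c : ℝ} (hc : 0 < c)
    (hint : Integrable (fun X => drift u c (block w X)) (noBacktrackLaw μ w))
    (hpos : 0 < ∫ X, drift u c (block w X) ∂noBacktrackLaw μ w) {q : ℝ} (hq0 : 0 ≤ q)
    (hq : q < 2 * p - 5) :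
    Summable fun N : ℕ => ((N : ℝ) + 1) ^ q * (averagedLaw μ).real (bad w u c N) := by
  obtain ⟨K, hK, C, hC, hev⟩ := exists_averagedLaw_bad_le μ w hs hw hp hmom u hc hint hpos
  have hsum : Summable fun N : ℕ => (N : ℝ) ^ (q + 4 - 2 * p) :=
    Real.summable_nat_rpow.2 (by linarith)
  refine summable_of_isBigO_nat hsum
    (Asymptotics.IsBigO.of_bound (2 ^ q * (3 * K + 9)) ?_)
  -- The exponent `-(4 + 2p)` brings the exponential term, with its prefactor of order `N ^ 8`, down
  -- to `N ^ (4 - 2p)`.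
  have hexp := ((isLittleO_exp_neg_mul_rpow_atTop (a := 1 / C) (by positivity)
    (-(4 + 2 * p))).bound one_pos)
  filter_upwards [hev, tendsto_natCast_atTop_atTop.eventually hexp, eventually_ge_atTop 1]
    with N hN he hN1
  have hN1' : (1 : ℝ) ≤ N := by exact_mod_cast hN1
  have hN0 : (0 : ℝ) < N := by linarith
  have hrp : (0 : ℝ) < (N : ℝ) ^ (-(2 * p)) := Real.rpow_pos_of_pos hN0 _
  have hreal : (averagedLaw μ).real (bad w u c N) ≤
      (2 * N ^ 4 + 1) * (K * (N : ℝ) ^ (-(2 * p))) +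
        (2 * N ^ 4 + 1) ^ 2 * Real.exp (-(1 / C * N)) :=
    ENNReal.toReal_le_of_le_ofReal (by positivity) hN
  rw [one_mul, Real.norm_eq_abs, Real.norm_eq_abs, abs_of_pos (Real.exp_pos _),
    abs_of_pos (Real.rpow_pos_of_pos hN0 _)] at he
  have hN4 : (2 * (N : ℝ) ^ 4 + 1) ≤ 3 * (N : ℝ) ^ (4 : ℝ) := by
    have : (1 : ℝ) ≤ (N : ℝ) ^ 4 := one_le_pow₀ hN1'
    have e : (N : ℝ) ^ (4 : ℝ) = (N : ℝ) ^ 4 := by norm_cast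
    rw [e]; linarith
  have hb : (averagedLaw μ).real (bad w u c N) ≤ (3 * K + 9) * (N : ℝ) ^ (4 - 2 * p) := by
    refine hreal.trans ?_
    have e1 : (2 * (N : ℝ) ^ 4 + 1) * (K * (N : ℝ) ^ (-(2 * p))) ≤
        3 * K * (N : ℝ) ^ (4 - 2 * p) := by
      rw [sub_eq_add_neg, Real.rpow_add hN0]
      calc _ ≤ 3 * (N : ℝ) ^ (4 : ℝ) * (K * (N : ℝ) ^ (-(2 * p))) := by gcongr
        _ = _ := by ring
    have e2 : (2 * (N : ℝ) ^ 4 + 1) ^ 2 * Real.exp (-(1 / C * N)) ≤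
        9 * (N : ℝ) ^ (4 - 2 * p) := by
      have hh : (4 : ℝ) - 2 * p = 4 + 4 + -(4 + 2 * p) := by ring
      rw [hh, Real.rpow_add hN0, Real.rpow_add hN0]
      calc _ ≤ (3 * (N : ℝ) ^ (4 : ℝ)) ^ 2 * (N : ℝ) ^ (-(4 + 2 * p)) := by
            gcongr
            rwa [← neg_mul]
        _ = _ := by ring
    linarith
  rw [Real.norm_eq_abs, Real.norm_eq_abs, abs_of_nonneg (by positivity), abs_of_nonneg (by positivity)]
  have hq1 : ((N : ℝ) + 1) ^ q ≤ 2 ^ q * (N : ℝ) ^ q := by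
    rw [← Real.mul_rpow (by norm_num) hN0.le]
    exact Real.rpow_le_rpow (by positivity) (by linarith) hq0
  calc _ ≤ (2 ^ q * (N : ℝ) ^ q) * ((3 * K + 9) * (N : ℝ) ^ (4 - 2 * p)) := by gcongr
    _ = _ := by
      rw [show q + 4 - 2 * p = q + (4 - 2 * p) by ring, Real.rpow_add hN0]
      ring

end

/-! ### Linear growth of the height at good scales. -/

theorem exists_block_index {s : ℕ → ℕ} (h0 : s 0 = 0) (hs : ∀ k, s k < s (k + 1)) (t : ℕ) :
    ∃ k ≤ t, s k ≤ t ∧ t < s (k + 1) := by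
  have hle : ∀ k, k ≤ s k := fun k => (strictMono_nat_of_lt_succ hs).le_apply
  have : ∃ k, s k ≤ t ∧ t < s (k + 1) := by
    induction t with
    | zero => exact ⟨0, h0.le, by have := hs 0; omega⟩
    | succ t ih =>
      obtain ⟨k, h1, h2⟩ := ih
      by_cases h : t + 1 < s (k + 1)
      · exact ⟨k, by omega, h⟩
      · exact ⟨k + 1, by omega, by have := hs (k + 1); omega⟩
  obtain ⟨k, h1, h2⟩ := this
  exact ⟨k, (hle k).trans h1, h1, h2⟩

/-- A lower bound for all increments of a Lipschitz sequence from a lower bound for its increments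
along a sparse sequence of times. -/
theorem le_increment_of_blocks {s : ℕ → ℕ} (h0 : s 0 = 0) (hs : ∀ k, s k < s (k + 1))
    {g : ℕ → ℝ} {n : ℕ} {B C D : ℝ} (hC : 0 ≤ C) (hD : 0 ≤ D)
    (hB : ∀ k ≤ n, (s (k + 1) : ℝ) - s k ≤ B)
    (hg : ∀ m l, |g (m + l) - g m| ≤ C * l)
    (hlow : ∀ i k, i + 1 + k ≤ n → -D ≤ g (s (i + 1 + k)) - g (s (i + 1)))
    {m l : ℕ} (hml : m + l ≤ n) : -D - 2 * C * B ≤ g (m + l) - g m := by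
  obtain ⟨i, hi, hi1, hi2⟩ := exists_block_index h0 hs m
  obtain ⟨j, hj, hj1, hj2⟩ := exists_block_index h0 hs (m + l)
  have hmono := (strictMono_nat_of_lt_succ hs).monotone
  have hij : i ≤ j := by
    by_contra h
    have := hmono (show j + 1 ≤ i by omega)
    omega
  have hBi := hB i (by omega)
  have hBj := hB j (by omega)
  have hsi : (s i : ℝ) ≤ m := by exact_mod_cast hi1
  have hB0 : 0 ≤ B := by
    have : (s i : ℝ) < s (i + 1) := by exact_mod_cast hs i
    linarith
  have hCB : 0 ≤ C * B := mul_nonneg hC hB0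
  -- Within one block the Lipschitz bound costs at most `C * B`. Otherwise the increment is compared
  -- with the one from the end of the block of `m` to the start of the block of `m + l`, at a cost
  -- of `C * B` on each side. The starting index `i + 1` is then never `0`.
  rcases hij.eq_or_lt with rfl | hlt
  · have h1 : (l : ℝ) ≤ B := by
      have : ((m + l : ℕ) : ℝ) < s (i + 1) := by exact_mod_cast hj2
      push_cast at this
      linarith
    have h2 := (abs_le.1 (hg m l)).1
    have h3 := mul_le_mul_of_nonneg_left h1 hC
    linarith
  · obtain ⟨k, rfl⟩ := Nat.exists_eq_add_of_le (Nat.succ_le_of_lt hlt)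
    have hl := hlow i k (by rw [Nat.succ_eq_add_one] at hj; omega)
    obtain ⟨a, ha⟩ := Nat.exists_eq_add_of_le hi2.le
    obtain ⟨b, hb⟩ := Nat.exists_eq_add_of_le hj1
    have h1 := (abs_le.1 (hg m a)).1
    rw [← ha] at h1
    have h2 := (abs_le.1 (hg (s (i + 1 + k)) b)).1
    rw [Nat.succ_eq_add_one] at hb hj2 hBj
    rw [← hb] at h2
    have ha' : (a : ℝ) ≤ B := by
      have : (s (i + 1) : ℝ) = m + a := by exact_mod_cast ha
      linarith
    have hb' : (b : ℝ) ≤ B := by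
      have e1 : ((m + l : ℕ) : ℝ) = s (i + 1 + k) + b := by exact_mod_cast hb
      have e2 : ((m + l : ℕ) : ℝ) < s (i + 1 + k + 1) := by exact_mod_cast hj2
      linarith
    have h3 := mul_le_mul_of_nonneg_left ha' hC
    have h4 := mul_le_mul_of_nonneg_left hb' hC
    linarith

/-- The end of the `k`-th regeneration block. -/
noncomputable def blockEnd {d : ℕ} (w : EuclideanSpace ℝ (Fin d)) (X : Path d) (k : ℕ) : ℕ :=
  ∑ i ∈ Finset.range k, blockLen w ((next w)^[i] X)

theorem iterate_next_apply {d : ℕ} (w : EuclideanSpace ℝ (Fin d)) {X : Path d} (h0 : X 0 = 0)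
    (k l : ℕ) : (next w)^[k] X l = X (blockEnd w X k + l) - X (blockEnd w X k) := by
  induction k generalizing l with
  | zero => simp [blockEnd, h0]
  | succ k ih =>
    rw [Function.iterate_succ_apply', next, shift, ih, ih, blockEnd, blockEnd,
      Finset.sum_range_succ, sub_sub_sub_cancel_right, ← add_assoc]

/-- Telescoping: a sum of block drifts is the increment of `height u (X t) - 2 * c * t` between
block ends. -/
theorem sum_drift_eq {d : ℕ} (w u : EuclideanSpace ℝ (Fin d)) (c : ℝ) {X : Path d}
    (h0 : X 0 = 0) (i k : ℕ) :
    ∑ j ∈ Finset.range k, drift u c (block w ((next w)^[j] ((next w)^[i] X))) =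
      (height u (X (blockEnd w X (i + k))) - 2 * c * blockEnd w X (i + k)) -
        (height u (X (blockEnd w X i)) - 2 * c * blockEnd w X i) := by
  induction k with
  | zero => simp
  | succ k ih =>
    have e : blockEnd w X (i + (k + 1)) =
        blockEnd w X (i + k) + blockLen w ((next w)^[i + k] X) := by
      rw [← add_assoc, blockEnd, Finset.sum_range_succ]; rfl
    rw [Finset.sum_range_succ, ih, ← Function.iterate_add_apply, add_comm k i, drift, block, e,
      iterate_next_apply w h0, height_sub]
    push_cast
    ring

/-- At a good scale the height has no large decrease relative to a linear growth. -/
theorem height_increment_of_notMem_bad {d : ℕ} {w u : EuclideanSpace ℝ (Fin d)} {c M : ℝ}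
    (hc : 0 ≤ c) (hM : 0 ≤ M) {X : Path d} (h0 : X 0 = 0) (hsteps : StepsLE M X)
    (hblock : ∀ k, blockLen w ((next w)^[k] X) ≠ 0) {N : ℕ} (hbad : X ∉ bad w u c N)
    {m l : ℕ} (hml : m + l ≤ 2 * N ^ 4) :
    2 * c * l - (N : ℝ) ^ 3 - 2 * (‖u‖ * M + 2 * c) * (N : ℝ) ^ 2 ≤
      height u (X (m + l)) - height u (X m) := by
  simp only [bad, Set.mem_union, Set.mem_iUnion, Finset.mem_range, Set.mem_preimage,
    Set.mem_ofPred_eq, not_or, not_exists, not_lt] at hbad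
  obtain ⟨hb1, hb2⟩ := hbad
  have hsucc : ∀ k, blockEnd w X (k + 1) = blockEnd w X k + blockLen w ((next w)^[k] X) :=
    fun k => Finset.sum_range_succ _ _
  -- Blocks have length at least `1`, so at most `2 * N ^ 4` of them end by time `2 * N ^ 4`; this
  -- is the range controlled in `bad`.
  have key := le_increment_of_blocks (s := blockEnd w X) (by simp [blockEnd])
    (fun k => by rw [hsucc]; have := hblock k; omega)
    (g := fun t => height u (X t) - 2 * c * t) (n := 2 * N ^ 4) (B := (N : ℝ) ^ 2)
    (C := ‖u‖ * M + 2 * c) (D := (N : ℝ) ^ 3) (by positivity) (by positivity)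
    (fun k hk => by
      rw [hsucc]; push_cast
      linarith [hb1 k (by omega)])
    (fun m l => by
      have h1 := abs_le.1 (hsteps.abs_height_sub_le u m l)
      have h2 : 0 ≤ c * l := by positivity
      push_cast
      rw [abs_le]
      constructor <;> linarith [h1.1, h1.2])
    (fun i k hik => by
      have h1 := hb2 i (by omega) k (by omega)
      simp only [lowSum, Set.mem_ofPred_eq, not_and, not_le] at h1
      have h2 := h1 fun j hj => by
        rw [← Function.iterate_add_apply]
        exact hb1 _ (by omega)
      rw [sum_drift_eq w u c h0] at h2
      exact h2.le) hml
  push_cast at key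
  linarith

/-- If all scales from `N` on are good, the height grows linearly from every early time on. -/
theorem height_growth_of_forall_notMem_bad {d : ℕ} {w u : EuclideanSpace ℝ (Fin d)} {c M : ℝ}
    (hc : 0 ≤ c) (hM : 0 ≤ M) {X : Path d} (h0 : X 0 = 0) (hsteps : StepsLE M X)
    (hblock : ∀ k, blockLen w ((next w)^[k] X) ≠ 0) {A N : ℕ}
    (hA : 1 + 2 * (‖u‖ * M + 2 * c) ≤ c * A) (hA1 : 1 ≤ A) (hN : 8 * A ≤ N)
    (hbad : ∀ n ≥ N, X ∉ bad w u c n) {m l : ℕ} (hm : m ≤ N ^ 4) (hl : A * N ^ 3 ≤ l) :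
    height u (X m) + c * l ≤ height u (X (m + l)) := by
  classical
  have hN1 : 1 ≤ N := by omega
  have hself : ∀ n, n ≤ A * n ^ 3 := fun n =>
    (Nat.le_self_pow three_ne_zero n).trans (Nat.le_mul_of_pos_left _ hA1)
  -- The scale adapted to the lag `l`: large enough that `2 * n ^ 4` covers `m + l`, and small
  -- enough that the loss of order `n ^ 3` is absorbed by `c * l`.
  set n := Nat.findGreatest (fun n => A * n ^ 3 ≤ l) l with hn
  have hNn : N ≤ n := Nat.le_findGreatest ((hself N).trans hl) hl
  have hn1 : A * n ^ 3 ≤ l := Nat.findGreatest_spec (P := fun n => A * n ^ 3 ≤ l)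
    ((hself N).trans hl) hl
  have hn2 : l < A * (n + 1) ^ 3 := by
    by_contra h
    have h' := not_lt.1 h
    exact Nat.findGreatest_is_greatest (P := fun n => A * n ^ 3 ≤ l) (Nat.lt_succ_self n)
      ((hself _).trans h') h'
  have hn0 : 1 ≤ n := hN1.trans hNn
  have hl4 : l ≤ n ^ 4 := by
    have h1 : (n + 1) ^ 3 ≤ (2 * n) ^ 3 := Nat.pow_le_pow_left (by omega) 3
    calc l ≤ A * (n + 1) ^ 3 := hn2.le
      _ ≤ A * (2 * n) ^ 3 := Nat.mul_le_mul_left _ h1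
      _ = (8 * A) * n ^ 3 := by ring
      _ ≤ n * n ^ 3 := Nat.mul_le_mul_right _ (hN.trans hNn)
      _ = n ^ 4 := by ring
  have hm4 : m ≤ n ^ 4 := hm.trans (Nat.pow_le_pow_left hNn 4)
  have key := height_increment_of_notMem_bad hc hM h0 hsteps hblock (hbad n hNn)
    (m := m) (l := l) (by omega)
  have hn0' : (1 : ℝ) ≤ n := by exact_mod_cast hn0
  have h23 : (n : ℝ) ^ 2 ≤ (n : ℝ) ^ 3 := pow_le_pow_right₀ hn0' (by norm_num)
  have hl' : (A : ℝ) * (n : ℝ) ^ 3 ≤ l := by exact_mod_cast hn1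
  have h1 : 2 * (‖u‖ * M + 2 * c) * (n : ℝ) ^ 2 ≤ 2 * (‖u‖ * M + 2 * c) * (n : ℝ) ^ 3 := by
    gcongr
  have h2 := mul_le_mul_of_nonneg_right hA (show (0 : ℝ) ≤ (n : ℝ) ^ 3 by positivity)
  have h3 := mul_le_mul_of_nonneg_left hl' hc
  -- The total loss is at most `c * A * n ^ 3 ≤ c * l`, that is, half of the growth `2 * c * l`.
  nlinarith

/-! ### Successive attempts to regenerate in direction `u`. -/

/-- The `k`-th attempt of a regeneration takes place at time `n`: the first attempt is at the first
record, the following ones at the first record after a failure of the previous one. -/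
def attempt {d : ℕ} (u : EuclideanSpace ℝ (Fin d)) : ℕ → ℕ → Set (Path d)
  | 0, n => {X | IsLeast {n | 1 ≤ n ∧ X ∈ record u n} n}
  | k + 1, n => {X | ∃ m < n, X ∈ attempt u k m ∧
      IsLeast {n | (∃ r, m < r ∧ r < n ∧ height u (X r) < height u (X m)) ∧ X ∈ record u n} n}

theorem dependsUpTo_isLeast {d : ℕ} {Q : ℕ → Set (Path d)} (hQ : ∀ n, DependsUpTo n (Q n))
    (n : ℕ) : DependsUpTo n {X | IsLeast {n | X ∈ Q n} n} := by
  rintro X ⟨h1, h2⟩ Y hY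
  refine ⟨hQ n X h1 Y hY, fun k hk => ?_⟩
  by_contra hkn
  have hkn' : k < n := not_le.1 hkn
  exact hkn (h2 (hQ k Y hk X fun i hi => (hY i (by omega)).symm))

theorem dependsUpTo_attempt {d : ℕ} (u : EuclideanSpace ℝ (Fin d)) (k n : ℕ) :
    DependsUpTo n (attempt u k n) := by
  induction k generalizing n with
  | zero =>
    exact dependsUpTo_isLeast (Q := fun n => {X | 1 ≤ n ∧ X ∈ record u n})
      (fun n X hX Y hY => ⟨hX.1, dependsUpTo_record u n X hX.2 Y hY⟩) n
  | succ k ih =>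
    rintro X ⟨m, hm, h1, h2⟩ Y hY
    refine ⟨m, hm, ih m X h1 Y fun i hi => hY i (hi.trans hm.le), ?_⟩
    have hm2 : ∀ {r n' : ℕ}, m < r → r < n' → m ≤ n' ∧ r ≤ n' := by omega
    exact dependsUpTo_isLeast (Q := fun n => {X | (∃ r, m < r ∧ r < n ∧
      height u (X r) < height u (X m)) ∧ X ∈ record u n})
      (fun n X hX Y hY => by
        obtain ⟨⟨r, hr1, hr2, hr3⟩, hX2⟩ := hX
        refine ⟨⟨r, hr1, hr2, ?_⟩, dependsUpTo_record u n X hX2 Y hY⟩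
        rw [hY r (hm2 hr1 hr2).2, hY m (hm2 hr1 hr2).1]
        exact hr3) n X h2 Y hY

theorem attempt_subset_record {d : ℕ} (u : EuclideanSpace ℝ (Fin d)) (k n : ℕ) :
    attempt u k n ⊆ record u n := by
  cases k with
  | zero => exact fun X hX => hX.1.2
  | succ k => rintro X ⟨m, _, _, h⟩; exact h.1.2

theorem one_le_of_mem_attempt {d : ℕ} {u : EuclideanSpace ℝ (Fin d)} {k n : ℕ} {X : Path d}
    (h : X ∈ attempt u k n) : 1 ≤ n := by
  cases k with
  | zero => exact h.1.1
  | succ k => obtain ⟨m, hm, _⟩ := h; omega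

theorem attempt_unique {d : ℕ} {u : EuclideanSpace ℝ (Fin d)} {k n n' : ℕ} {X : Path d}
    (h : X ∈ attempt u k n) (h' : X ∈ attempt u k n') : n = n' := by
  induction k generalizing n n' with
  | zero => exact IsLeast.unique h h'
  | succ k ih =>
    obtain ⟨m, _, h1, h2⟩ := h
    obtain ⟨m', _, h1', h2'⟩ := h'
    obtain rfl := ih h1 h1'
    exact IsLeast.unique h2 h2'

/-- The first time at which the path exceeds all its heights up to time `r` is a record. -/
theorem exists_record {d : ℕ} {u : EuclideanSpace ℝ (Fin d)} {X : Path d} {r t : ℕ}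
    (h : ∀ i ≤ r, height u (X i) < height u (X t)) : ∃ n, r < n ∧ n ≤ t ∧ X ∈ record u n := by
  classical
  have hex : ∃ n, ∀ i ≤ r, height u (X i) < height u (X n) := ⟨t, h⟩
  refine ⟨Nat.find hex, ?_, Nat.find_min' hex h, fun j hj => ?_⟩
  · by_contra hn
    exact lt_irrefl _ (Nat.find_spec hex _ (not_lt.1 hn))
  · by_cases hjr : j ≤ r
    · exact Nat.find_spec hex j hjr
    · have := Nat.find_min hex hj
      push Not at this
      obtain ⟨i, hi, hij⟩ := this
      exact hij.trans_lt (Nat.find_spec hex i hi)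

theorem exists_isLeast_le {S : Set ℕ} {n : ℕ} (h : n ∈ S) : ∃ k ≤ n, IsLeast S k := by
  classical
  exact ⟨Nat.find ⟨n, h⟩, Nat.find_min' _ h, Nat.find_spec (⟨n, h⟩ : ∃ n, n ∈ S),
    fun k hk => Nat.find_min' _ hk⟩

/-- If the height grows linearly after a lag `L`, failing attempts follow each other quickly. -/
theorem exists_attempt {d : ℕ} {u : EuclideanSpace ℝ (Fin d)} {c M : ℝ} (hc : 0 < c)
    (hM : 0 ≤ M) {X : Path d} (hsteps : StepsLE M X) {T L R : ℕ} (hL : 1 ≤ L) (hLR : L ≤ R)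
    (hR : ‖u‖ * M * L < c * R)
    (hgrow : ∀ m ≤ T, ∀ l ≥ L, height u (X m) + c * l ≤ height u (X (m + l)))
    (hno : ∀ n ≤ T, ¬ IsRegen u n X) (k : ℕ) (hk : (k + 1) * R ≤ T) :
    ∃ n ≤ (k + 1) * R, X ∈ attempt u k n := by
  have hR0 : (0 : ℝ) < R := by exact_mod_cast (hL.trans hLR)
  induction k with
  | zero =>
    obtain ⟨n, hn1, hn2, hn3⟩ := exists_record (u := u) (X := X) (r := 0) (t := R) fun i hi => by
      obtain rfl := Nat.le_zero.1 hi
      have := hgrow 0 (Nat.zero_le _) R hLR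
      rw [zero_add] at this
      have : 0 < c * R := by positivity
      linarith
    obtain ⟨n', hn', hleast⟩ := exists_isLeast_le
      (S := {n | 1 ≤ n ∧ X ∈ record u n}) (n := n) ⟨hn1, hn3⟩
    exact ⟨n', by omega, hleast⟩
  | succ k ih =>
    have hexp : (k + 1 + 1) * R = (k + 1) * R + R := by ring
    obtain ⟨m, hm, hatt⟩ := ih (by omega)
    have hmT : m ≤ T := by omega
    -- An attempt is a record, so without a regeneration at `m` the path must go below `X m` later.
    have hrec := attempt_subset_record u k m hatt
    obtain ⟨r, hmr, hr⟩ : ∃ r ≥ m, height u (X r) < height u (X m) := by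
      by_contra! h
      exact hno m hmT ⟨one_le_of_mem_attempt hatt, hrec, h⟩
    obtain ⟨b, rfl⟩ := Nat.exists_eq_add_of_le hmr
    have hb0 : b ≠ 0 := by
      rintro rfl
      exact lt_irrefl _ hr
    -- Linear growth after the lag `L` forces the failure to happen before it.
    have hbL : b < L := by
      by_contra h
      have := hgrow m hmT b (not_lt.1 h)
      have : 0 ≤ c * b := by positivity
      linarith
    -- At `m + R` the height exceeds that of `X m` by at least `c * R`, more than any rise of `‖u‖ *
    -- M * L` possible before the failure. Earlier heights are below `X m` because `m` is a record.
    obtain ⟨n, hn1, hn2, hn3⟩ := exists_record (u := u) (X := X) (r := m + b) (t := m + R)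
      fun i hi => by
        have ht := hgrow m hmT R hLR
        rcases lt_or_ge i m with him | him
        · have := hrec i him
          have : 0 < c * R := by positivity
          linarith
        · obtain ⟨a, rfl⟩ := Nat.exists_eq_add_of_le him
          have h1 := (abs_le.1 (hsteps.abs_height_sub_le u m a)).2
          have h2 : (a : ℝ) ≤ L := by exact_mod_cast (by omega : a ≤ L)
          have h3 := mul_le_mul_of_nonneg_left h2 (mul_nonneg (norm_nonneg u) hM)
          linarith
    obtain ⟨n', hn', hleast⟩ := exists_isLeast_le
      (S := {n | (∃ r, m < r ∧ r < n ∧ height u (X r) < height u (X m)) ∧ X ∈ record u n})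
      (n := n) ⟨⟨m + b, by omega, hn1, hr⟩, hn3⟩
    obtain ⟨⟨r, h1, h2, _⟩, _⟩ := hleast.1
    exact ⟨n', by omega, m, h1.trans h2, hatt, hleast⟩

section

variable {d : ℕ} (μ : Measure (JumpLaw d)) [IsProbabilityMeasure μ]

/-- A next attempt requires failure of the current one. Being at a record and decided by the past,
the current attempt fails with probability `1 - ρ` independently of that past; disjointness of its
possible times lets these be summed. -/
theorem averagedLaw_attempt_le (u : EuclideanSpace ℝ (Fin d)) (k : ℕ) :
    averagedLaw μ (⋃ n, attempt u k n) ≤ (1 - averagedLaw μ (noBack u)) ^ k := by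
  induction k with
  | zero => simpa using prob_le_one
  | succ k ih =>
    have hsub : (⋃ n, attempt u (k + 1) n) ⊆
        ⋃ m, (attempt u k m \ shift m ⁻¹' noBack u) := by
      intro X hX
      obtain ⟨n, m, _, h1, h2⟩ := Set.mem_iUnion.1 hX
      obtain ⟨⟨r, hr1, _, hr3⟩, _⟩ := h2.1
      refine Set.mem_iUnion.2 ⟨m, h1, fun h => ?_⟩
      exact absurd hr3 (not_lt.2 ((mem_shift_noBack_iff u m X).1 h r hr1.le))
    have hone : ∀ m, averagedLaw μ (attempt u k m \ shift m ⁻¹' noBack u) =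
        averagedLaw μ (attempt u k m) * (1 - averagedLaw μ (noBack u)) := by
      intro m
      have h1 := averagedLaw_inter_shift_noBack μ u (dependsUpTo_attempt u k m)
        (attempt_subset_record u k m) MeasurableSet.univ
      rw [Set.inter_univ] at h1
      have h2 := measure_sdiff_add_inter (μ := averagedLaw μ) (attempt u k m)
        (measurable_shift m (measurableSet_noBack u))
      rw [h1] at h2
      rw [ENNReal.mul_sub fun _ _ => measure_ne_top _ _, mul_one]
      exact ENNReal.eq_sub_of_add_eq
        (ENNReal.mul_ne_top (measure_ne_top _ _) (measure_ne_top _ _)) h2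
    calc averagedLaw μ (⋃ n, attempt u (k + 1) n)
        ≤ ∑' m, averagedLaw μ (attempt u k m \ shift m ⁻¹' noBack u) :=
          (measure_mono hsub).trans (measure_iUnion_le _)
      _ = averagedLaw μ (⋃ m, attempt u k m) * (1 - averagedLaw μ (noBack u)) := by
          simp_rw [hone]
          rw [ENNReal.tsum_mul_right, measure_iUnion _ fun m =>
            (dependsUpTo_attempt u k m).measurableSet]
          intro a b hab
          exact Set.disjoint_left.2 fun X ha hb => hab (attempt_unique ha hb)
      _ ≤ _ := by
          rw [pow_succ]
          gcongr

end

/-! ### Series estimates. -/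

theorem summable_rpow_mul_pow_div {r : ℝ} (hr0 : 0 ≤ r) (hr1 : r < 1) {R : ℕ} (hR : 1 ≤ R)
    (q : ℝ) : Summable fun N : ℕ => ((N : ℝ) + 1) ^ q * r ^ (N / R - 1) := by
  -- The ratio `r = 0` has no logarithm; it is dominated by `1 / 2`.
  wlog hr : 0 < r generalizing r
  · have h := this (r := 1 / 2) (by norm_num) (by norm_num) (by norm_num)
    refine h.of_nonneg_of_le (fun N => by positivity) fun N => ?_
    have : r ≤ 1 / 2 := by linarith [not_lt.1 hr]
    gcongr
  have hR0 : (0 : ℝ) < R := by exact_mod_cast hR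
  have hlog : Real.log r < 0 := Real.log_neg hr hr1
  set a : ℝ := -Real.log r / R with ha
  have ha0 : 0 < a := div_pos (neg_pos.2 hlog) hR0
  have hpow : ∀ N : ℕ, r ^ (N / R - 1) ≤ r ^ (-2 : ℝ) * Real.exp (-a * N) := by
    intro N
    -- One unit is lost to integer division and one to the (truncated) subtraction.
    have h1 : (N : ℝ) / R - 2 ≤ ((N / R - 1 : ℕ) : ℝ) := by
      have h2 : N < R * (N / R + 1) := Nat.lt_mul_div_succ N hR
      have h3 : N / R ≤ (N / R - 1) + 1 := by omega
      have h2' : (N : ℝ) < R * ((N / R : ℕ) + 1) := by exact_mod_cast h2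
      have h3' : ((N / R : ℕ) : ℝ) ≤ ((N / R - 1 : ℕ) : ℝ) + 1 := by exact_mod_cast h3
      rw [sub_le_iff_le_add, div_le_iff₀ hR0]
      nlinarith
    rw [← Real.rpow_natCast]
    calc r ^ (((N / R - 1 : ℕ) : ℝ)) ≤ r ^ ((N : ℝ) / R - 2) :=
          Real.rpow_le_rpow_of_exponent_ge hr hr1.le h1
      _ = _ := by
          rw [sub_eq_neg_add, Real.rpow_add hr, Real.rpow_def_of_pos hr ((N : ℝ) / R), ha]
          congr 2
          field_simp
  refine summable_of_isBigO_nat (g := fun N : ℕ => (N : ℝ) ^ (-2 : ℝ))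
    (Real.summable_nat_rpow.2 (by norm_num))
    (Asymptotics.IsBigO.of_bound (2 ^ |q| * r ^ (-2 : ℝ)) ?_)
  have hexp := (isLittleO_exp_neg_mul_rpow_atTop ha0 (-(|q| + 2))).bound one_pos
  filter_upwards [tendsto_natCast_atTop_atTop.eventually hexp, eventually_ge_atTop 1] with N he hN
  have hN1 : (1 : ℝ) ≤ N := by exact_mod_cast hN
  have hN0 : (0 : ℝ) < N := by linarith
  rw [one_mul, Real.norm_eq_abs, Real.norm_eq_abs, abs_of_pos (Real.exp_pos _),
    abs_of_pos (Real.rpow_pos_of_pos hN0 _)] at he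
  rw [Real.norm_of_nonneg (by positivity), Real.norm_of_nonneg (by positivity)]
  have hq1 : ((N : ℝ) + 1) ^ q ≤ 2 ^ |q| * (N : ℝ) ^ |q| := by
    rw [← Real.mul_rpow (by norm_num) hN0.le]
    exact (Real.rpow_le_rpow_of_exponent_le (by linarith) (le_abs_self q)).trans
      (Real.rpow_le_rpow (by positivity) (by linarith) (abs_nonneg q))
  calc ((N : ℝ) + 1) ^ q * r ^ (N / R - 1)
      ≤ (2 ^ |q| * (N : ℝ) ^ |q|) * (r ^ (-2 : ℝ) * (N : ℝ) ^ (-(|q| + 2))) := by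
        gcongr
        exact (hpow N).trans (by gcongr)
    _ = _ := by
        rw [show (-2 : ℝ) = |q| + -(|q| + 2) by ring, Real.rpow_add hN0]
        ring

/-- A single term suffices for finite `τ`: the one with `N ^ 4 < τ ≤ (N + 1) ^ 4`. For infinite `τ`
every term is at least `1`. -/
theorem rpow_le_tsum_indicator {t : ℝ≥0∞} {τ : ℕ∞} (hτ : 1 ≤ τ) (ht : t = τ) {p : ℝ}
    (hp : 0 ≤ p) :
    t ^ p ≤ ∑' N : ℕ, if ((N ^ 4 : ℕ) : ℝ≥0∞) < t then
      ENNReal.ofReal (((N : ℝ) + 1) ^ (4 * p)) else 0 := by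
  classical
  have hone : ∀ N : ℕ, (1 : ℝ) ≤ ((N : ℝ) + 1) ^ (4 * p) := fun N =>
    Real.one_le_rpow (by linarith [(Nat.cast_nonneg N : (0 : ℝ) ≤ N)]) (by positivity)
  cases τ with
  | top =>
    have ht' : t = ⊤ := ht
    refine le_top.trans (top_le_iff.2 ?_).ge
    rw [eq_top_iff, ← ENNReal.tsum_const_eq_top_of_ne_zero (α := ℕ) one_ne_zero]
    refine ENNReal.tsum_le_tsum fun N => ?_
    rw [if_pos (by rw [ht']; exact ENNReal.natCast_lt_top _)]
    exact ENNReal.one_le_ofReal.2 (hone N)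
  | coe n =>
    have ht' : t = (n : ℝ≥0∞) := ht
    have hn : 1 ≤ n := by exact_mod_cast hτ
    have hex : ∃ N, n ≤ (N + 1) ^ 4 :=
      ⟨n, (Nat.le_succ n).trans (Nat.le_self_pow (by norm_num) _)⟩
    set N := Nat.find hex with hN
    have h1 : n ≤ (N + 1) ^ 4 := Nat.find_spec hex
    have h2 : N ^ 4 < n := by
      rcases Nat.eq_zero_or_pos N with h | h
      · rw [h]; omega
      · have := Nat.find_min hex (m := N - 1) (by omega)
        rw [Nat.sub_add_cancel h] at this
        omega
    refine le_trans ?_ (ENNReal.le_tsum N)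
    rw [ht', if_pos (by exact_mod_cast h2), Real.rpow_mul (by positivity),
      ← ENNReal.ofReal_rpow_of_nonneg (by positivity) hp, ← ENNReal.ofReal_natCast]
    gcongr
    have : ((N : ℝ) + 1) ^ (4 : ℝ) = ((N : ℝ) + 1) ^ 4 := by norm_cast
    rw [this]
    exact_mod_cast h1

/-- After exchanging the sums, `b n` is counted for `n + 1` values of `N`, each with weight at most
`(n + 1) ^ q`. -/
theorem tsum_tail_sum_le {b : ℕ → ℝ≥0∞} {q : ℝ} (hq : 0 ≤ q) :
    ∑' N : ℕ, ENNReal.ofReal (((N : ℝ) + 1) ^ q) * ∑' n, (if N ≤ n then b n else 0) ≤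
      ∑' n : ℕ, ENNReal.ofReal (((n : ℝ) + 1) ^ (q + 1)) * b n := by
  simp_rw [← ENNReal.tsum_mul_left]
  rw [ENNReal.tsum_comm]
  refine ENNReal.tsum_le_tsum fun n => ?_
  rw [tsum_eq_sum (s := Finset.range (n + 1)) fun N hN => by
    rw [Finset.mem_range] at hN
    rw [if_neg (by omega), mul_zero]]
  refine (Finset.sum_le_card_nsmul _ _ (ENNReal.ofReal (((n : ℝ) + 1) ^ q) * b n)
    fun N hN => ?_).trans_eq ?_
  · have hNn : N ≤ n := by
      have := Finset.mem_range.1 hN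
      omega
    rw [if_pos hNn]
    gcongr
  · have hn : (0 : ℝ) < (n : ℝ) + 1 := by positivity
    rw [Finset.card_range, nsmul_eq_mul, ← mul_assoc, Real.rpow_add hn, Real.rpow_one,
      ENNReal.ofReal_mul (by positivity), ← Nat.cast_succ, ENNReal.ofReal_natCast,
      Nat.succ_eq_add_one]
    ring

/-! ### Transience and the tail of the regeneration time in direction `u`. -/

section

variable {d : ℕ} (μ : Measure (JumpLaw d)) (w : EuclideanSpace ℝ (Fin d))

/-- By Borel–Cantelli almost every path is good at all large scales, and the growth estimate from
time `0` applies. -/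
theorem transientIn_of_summable_bad (u : EuclideanSpace ℝ (Fin d)) {c M : ℝ} (hc : 0 < c)
    (hM : 0 ≤ M)
    (hgood : ∀ᵐ X ∂averagedLaw μ, X 0 = 0 ∧ StepsLE M X ∧
      ∀ k, blockLen w ((next w)^[k] X) ≠ 0) {A : ℕ}
    (hA : 1 + 2 * (‖u‖ * M + 2 * c) ≤ c * A) (hA1 : 1 ≤ A)
    (hsum : ∑' n, averagedLaw μ (bad w u c n) ≠ ⊤) : TransientIn μ u := by
  filter_upwards [hgood, ae_eventually_notMem hsum] with X ⟨h0, hsteps, hblock⟩ hev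
  obtain ⟨N₀, hN₀⟩ := eventually_atTop.1 hev
  have hlin : Tendsto (fun n : ℕ => c * (n : ℝ)) atTop atTop :=
    tendsto_natCast_atTop_atTop.const_mul_atTop hc
  refine tendsto_atTop_mono' atTop ?_ hlin
  filter_upwards [eventually_ge_atTop (A * (max N₀ (8 * A)) ^ 3)] with l hl
  have := height_growth_of_forall_notMem_bad (u := u) hc.le hM h0 hsteps hblock hA hA1
    (N := max N₀ (8 * A)) (le_max_right _ _) (fun n hn => hN₀ n ((le_max_left _ _).trans hn))
    (m := 0) (Nat.zero_le _) hl
  rwa [h0, height_zero, zero_add, zero_add] at this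

variable [IsProbabilityMeasure μ]

theorem ae_blockLen_iterate_ne_zero (hw : TransientIn μ w)
    (hfin : ∀ᵐ X ∂averagedLaw μ, regenTime w X ≠ ⊤) :
    ∀ᵐ X ∂averagedLaw μ, ∀ k, blockLen w ((next w)^[k] X) ≠ 0 := by
  have h0 : ∀ᵐ X ∂averagedLaw μ, blockLen w X ≠ 0 := by
    filter_upwards [hfin] with X hX
    rwa [Ne, ← regenTime_eq_top_iff_blockLen]
  rw [ae_all_iff]
  rintro (_ | k)
  · exact h0
  · have h1 := (noBacktrackLaw_absolutelyContinuous μ w).ae_le h0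
    have hm : MeasurableSet {X : Path d | blockLen w X = 0} :=
      measurable_blockLen w (measurableSet_singleton 0)
    have h2 := averagedLaw_iterate_next μ w hw hfin k hm
    rw [ae_iff]
    have h3 := ae_iff.1 h1
    simp only [ne_eq, not_not] at h3
    rw [h3] at h2
    simpa using h2

/-- The tail of the regeneration time along fourth powers. -/
theorem averagedLaw_regenTime_gt_le (u : EuclideanSpace ℝ (Fin d)) {c M : ℝ} (hc : 0 < c)
    (hM : 0 ≤ M)
    (hgood : ∀ᵐ X ∂averagedLaw μ, X 0 = 0 ∧ StepsLE M X ∧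
      ∀ k, blockLen w ((next w)^[k] X) ≠ 0) {A R N : ℕ}
    (hA : 1 + 2 * (‖u‖ * M + 2 * c) ≤ c * A) (hA1 : 1 ≤ A) (hAR : A ≤ R)
    (hR : ‖u‖ * M * A < c * R) (hN : 8 * A ≤ N) (hNR : R ≤ N) :
    averagedLaw μ {X | ((N ^ 4 : ℕ) : ℝ≥0∞) < (regenTime u X : ℝ≥0∞)} ≤
      (∑' n, if N ≤ n then averagedLaw μ (bad w u c n) else 0) +
        (1 - averagedLaw μ (noBack u)) ^ (N / R - 1) := by
  have hN1 : 1 ≤ N := by omega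
  have hsub : {X | ((N ^ 4 : ℕ) : ℝ≥0∞) < (regenTime u X : ℝ≥0∞)} ≤ᵐ[averagedLaw μ]
      ((⋃ n, if N ≤ n then bad w u c n else ∅) ∪ ⋃ n, attempt u (N / R - 1) n : Set (Path d)) := by
    filter_upwards [hgood] with X ⟨h0, hsteps, hblock⟩ hX
    have hX' : ((N ^ 4 : ℕ) : ℝ≥0∞) < (regenTime u X : ℝ≥0∞) := hX
    by_cases hb : ∀ n ≥ N, X ∉ bad w u c n
    · right
      have hno : ∀ n ≤ N ^ 4, ¬ IsRegen u n X := by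
        intro n hn hreg
        have h1 := regenTime_le hreg
        have h2 : (regenTime u X : ℝ≥0∞) ≤ ((n : ℕ∞) : ℝ≥0∞) := ENat.toENNReal_le.2 h1
        have h3 : ((n : ℕ∞) : ℝ≥0∞) ≤ ((N ^ 4 : ℕ) : ℝ≥0∞) := by
          rw [ENat.toENNReal_coe]
          exact_mod_cast hn
        exact absurd hX' (not_lt.2 (h2.trans h3))
      have hN3 : 1 ≤ N ^ 3 := Nat.one_le_pow _ _ hN1
      have hN3' : (0 : ℝ) < (N : ℝ) ^ 3 := by positivity
      have hk : N / R - 1 + 1 = N / R :=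
        Nat.sub_add_cancel ((Nat.one_le_div_iff (by omega)).2 hNR)
      -- With spacing `R * N ^ 3`, the attempts numbered `0` to `N / R - 1` fit into the first `N ^
      -- 4` steps.
      obtain ⟨n, _, hn⟩ := exists_attempt hc hM hsteps (T := N ^ 4) (L := A * N ^ 3)
        (R := R * N ^ 3) (Nat.mul_pos hA1 hN3) (Nat.mul_le_mul_right _ hAR)
        (by
          push_cast
          have := mul_lt_mul_of_pos_right hR hN3'
          linarith)
        (fun m hm l hl => height_growth_of_forall_notMem_bad hc.le hM h0 hsteps hblock hA hA1 hN
          hb hm hl) hno (N / R - 1) (by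
          rw [hk]
          calc N / R * (R * N ^ 3) = (N / R * R) * N ^ 3 := by ring
            _ ≤ N * N ^ 3 := Nat.mul_le_mul_right _ (Nat.div_mul_le_self N R)
            _ = N ^ 4 := by ring)
      exact Set.mem_iUnion.2 ⟨n, hn⟩
    · left
      push Not at hb
      obtain ⟨n, hn, hXn⟩ := hb
      exact Set.mem_iUnion.2 ⟨n, by rwa [if_pos hn]⟩
  refine (measure_mono_ae hsub).trans ((measure_union_le _ _).trans
    (add_le_add ((measure_iUnion_le _).trans_eq (tsum_congr fun n => ?_))
      (averagedLaw_attempt_le μ u _)))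
  split_ifs <;> simp

end

theorem tsum_ofReal_mul_measure_ne_top {Ω : Type*} [MeasurableSpace Ω] (ν : Measure Ω)
    [IsFiniteMeasure ν] {s : ℕ → Set Ω} {a : ℕ → ℝ} (ha : ∀ n, 0 ≤ a n)
    (h : Summable fun n => a n * ν.real (s n)) :
    ∑' n, ENNReal.ofReal (a n) * ν (s n) ≠ ⊤ := by
  have := h.tsum_ofReal_ne_top
  convert this using 3 with n
  rw [ENNReal.ofReal_mul (ha n), ofReal_measureReal]

end RWRE

/-! ### Conclusion. -/

theorem propositionB1 {d : ℕ} (μ : MeasureTheory.Measure (RWRE.JumpLaw d))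
    [MeasureTheory.IsProbabilityMeasure μ] (hsteps : RWRE.BoundedSteps μ)
    (w : EuclideanSpace ℝ (Fin d)) (hw : RWRE.TransientIn μ w)
    (p₃ : ℝ) (hp₃ : 6 < p₃) (hmom : RWRE.regenMoment μ w p₃ < ⊤)
    (u : EuclideanSpace ℝ (Fin d)) (huv : 0 < inner ℝ u (RWRE.velocity μ w)) :
    RWRE.TransientIn μ u ∧
      ∀ p₀ : ℝ, p₀ < p₃ / 2 - 2 → RWRE.regenMoment μ u p₀ < ⊤ := by
  open RWRE in
  have hp2 : 2 ≤ p₃ := by linarith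
  obtain ⟨c, hc, hint, hpos⟩ := exists_drift_pos μ w hsteps hw hp2 hmom u huv
  have hsum := fun {q : ℝ} (hq0 : 0 ≤ q) (hq : q < 2 * p₃ - 5) =>
    tsum_ofReal_mul_measure_ne_top (averagedLaw μ) (fun n => by positivity)
      (summable_averagedLaw_bad μ w hsteps hw hp2 hmom u hc hint hpos hq0 hq)
  obtain ⟨M, hM, hX⟩ := ae_bounded_steps μ hsteps
  have hfin := ae_regenTime_ne_top μ w (by linarith) hmom
  have hgood : ∀ᵐ X ∂averagedLaw μ, X 0 = 0 ∧ StepsLE M X ∧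
      ∀ k, blockLen w ((next w)^[k] X) ≠ 0 := by
    filter_upwards [ae_eq_zero_start μ, hX, ae_blockLen_iterate_ne_zero μ w hw hfin]
      with X h1 h2 h3 using ⟨h1, h2, h3⟩
  obtain ⟨A, hA⟩ := exists_nat_ge ((1 + 2 * (‖u‖ * M + 2 * c)) / c)
  rw [div_le_iff₀' hc] at hA
  have hA1 : 1 ≤ A := by
    rw [Nat.one_le_iff_ne_zero]
    rintro rfl
    have : 0 ≤ ‖u‖ * M := by positivity
    simp only [Nat.cast_zero, mul_zero] at hA
    linarith
  have htrans : TransientIn μ u := by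
    refine transientIn_of_summable_bad μ w u hc hM.le hgood hA hA1 ?_
    simpa using hsum (q := 0) le_rfl (by linarith)
  refine ⟨htrans, fun p₀ hp₀ => ?_⟩
  obtain ⟨R₀, hR₀⟩ := exists_nat_gt (‖u‖ * M * A / c)
  rw [div_lt_iff₀' hc] at hR₀
  set R := max R₀ A with hRdef
  have hR : ‖u‖ * M * A < c * R :=
    hR₀.trans_le (by gcongr; exact le_max_left _ _)
  -- Since `τ₁ ≥ 1`, raising a negative exponent to `0` only increases the moment.
  set p := max p₀ 0 with hp
  have hp0 : 0 ≤ p := le_max_right _ _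
  have hp3 : p < p₃ / 2 - 2 := max_lt hp₀ (by linarith)
  set ρ := averagedLaw μ (noBack u) with hρ
  have hρ0 : 0 < ρ := averagedLaw_noBack_pos μ u htrans
  have hr1 : (1 - ρ).toReal < 1 := by
    rw [← ENNReal.toReal_one]
    exact ENNReal.toReal_strict_mono ENNReal.one_ne_top
      (ENNReal.sub_lt_self ENNReal.one_ne_top one_ne_zero hρ0.ne')
  set N₁ := max (8 * A) R
  set S : ℕ → Set (Path d) := fun N => {X | ((N ^ 4 : ℕ) : ℝ≥0∞) < (regenTime u X : ℝ≥0∞)}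
  have hS : ∀ N, MeasurableSet (S N) := fun N =>
    measurableSet_lt measurable_const (measurable_coe_regenTime u)
  set f : ℕ → ℝ≥0∞ := fun N => ENNReal.ofReal (((N : ℝ) + 1) ^ (4 * p))
  have hmoment : regenMoment μ u p₀ ≤ ∑' N, f N * averagedLaw μ (S N) := by
    calc regenMoment μ u p₀ ≤ ∫⁻ X, ∑' N, (S N).indicator (fun _ => f N) X ∂averagedLaw μ := by
          refine lintegral_mono fun X => ?_
          have h1 : (1 : ℝ≥0∞) ≤ (regenTime u X : ℝ≥0∞) := by
            rw [← ENat.toENNReal_one]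
            exact ENat.toENNReal_le.2 (one_le_regenTime u X)
          refine (ENNReal.rpow_le_rpow_of_exponent_le h1 (le_max_left p₀ 0)).trans
            ((rpow_le_tsum_indicator (one_le_regenTime u X) rfl hp0).trans_eq (tsum_congr fun N => ?_))
          by_cases h : X ∈ S N
          · rw [Set.indicator_of_mem h]
            exact if_pos h
          · rw [Set.indicator_of_notMem h]
            exact if_neg h
      _ = ∑' N, f N * averagedLaw μ (S N) := by
          rw [lintegral_tsum fun N => (measurable_const.indicator (hS N)).aemeasurable]
          simp_rw [lintegral_indicator (hS _), setLIntegral_const]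
  have hterm : ∀ N, f N * averagedLaw μ (S N) ≤
      f N * (∑' n, if N ≤ n then averagedLaw μ (bad w u c n) else 0) +
        (ENNReal.ofReal (((N : ℝ) + 1) ^ (4 * p) * (1 - ρ).toReal ^ (N / R - 1)) +
          if N < N₁ then f N else 0) := by
    intro N
    -- Below `N₁` the tail estimate is not available; these finitely many terms are bounded by `f
    -- N`.
    by_cases hN : N < N₁
    · rw [if_pos hN, ← add_assoc]
      exact (mul_le_of_le_one_right' prob_le_one).trans le_add_self
    · rw [if_neg hN, add_zero, ENNReal.ofReal_mul (by positivity),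
        ENNReal.ofReal_pow ENNReal.toReal_nonneg, ENNReal.ofReal_toReal (by simp), ← mul_add]
      have hN' := not_lt.1 hN
      gcongr
      exact averagedLaw_regenTime_gt_le μ w u hc hM.le hgood hA hA1 (le_max_right _ _) hR
        ((le_max_left _ _).trans hN') ((le_max_right _ _).trans hN')
  refine hmoment.trans_lt ((ENNReal.tsum_le_tsum hterm).trans_lt ?_)
  rw [ENNReal.tsum_add, ENNReal.tsum_add]
  refine ENNReal.add_lt_top.2 ⟨?_, ENNReal.add_lt_top.2 ⟨?_, ?_⟩⟩
  -- The tail sum costs one power, so the weight needed is `4 * p + 1`; it lies below `2 * p₃ - 5`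
  -- because `p < p₃ / 2 - 2`.
  · exact (tsum_tail_sum_le (by positivity)).trans_lt
      (hsum (q := 4 * p + 1) (by positivity) (by linarith)).lt_top
  · exact (summable_rpow_mul_pow_div ENNReal.toReal_nonneg hr1
      (hA1.trans (le_max_right _ _)) (4 * p)).tsum_ofReal_lt_top
  · rw [tsum_eq_sum (s := Finset.range N₁) fun N hN => if_neg (by simpa using hN)]
    refine ENNReal.sum_lt_top.2 fun N _ => ?_
    split_ifs
    · exact ENNReal.ofReal_lt_top
    · exact ENNReal.zero_lt_top
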